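/- All logarithms are to base $2$ and $0\log 0=0$. Let $h(x)=-x\log x-(1-x)\log(1-x)$ for $x\in[0,1]$ and $\tilde h(x)=h(\min(x,1/2))$. Let $\mathcal X,\mathcal Y$ be finite sets and $f\colon\mathcal X\times\mathcal Y\to\mathcal Z$ a function. A (randomized two-party) protocol $\pi$ consists of a public random string $R$ and private random strings $R_A$ (Alice) and $R_B$ (Bob), which are independent of each other and of the inputs and have arbitrary distributions on arbitrary finite sets, and, for each value of $R$, a finite protocol tree: each inner node is owned by one player, who sends one bit that is a function of that player's input and private string (given $R$), and each leaf is labelled by the common output $\pi(x,y)\in\mathcal Z$. The transcript $\Pi$ consists of $R$ and the transmitted bits. For a probability distribution $\mu$ on $\mathcal X\times\mathcal Y$ and $(X,Y)\sim\mu$, the information cost is $\mathrm{IC}_\mu(\pi)=I(\Pi;X\mid Y)+I(\Pi;Y\mid X)$. Let $\mathrm{IC}_\mu(f,\mu,\epsilon)$ be the infimum of $\mathrm{IC}_\mu(\pi)$ over all protocols $\pi$ with $\Pr_{(x,y)\sim\mu}[\pi(x,y)\ne f(x,y)]\le\epsilon$, and let $\mathrm{ICD}(f,\epsilon)=\sup_\mu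 \mathrm{IC}_\mu(f,\mu,\epsilon)$, the supremum over all probability distributions $\mu$ on $\mathcal X\times\mathcal Y$. **Theorem.** Suppose that $f$ is non-constant. 1. There is a constant $c>0$, depending only on $f$, such that for all $\epsilon\in[0,1]$ $$\mathrm{ICD}(f,\epsilon)\le \mathrm{ICD}(f,0)-c\,h(\epsilon).$$ 2. If the supremum that defines $\mathrm{ICD}(f,0)$ is a maximum, that is, $\mathrm{ICD}(f,0)=\mathrm{IC}_\mu(f,\mu,0)$ for some $\mu$, then there is a constant $C>0$, depending only on $f$, such that for all $\epsilon\in[0,1]$ $$\mathrm{ICD}(f,0)-C\,\tilde h(\sqrt\epsilon)\le \mathrm{ICD}(f,\epsilon).$$ -/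

import Mathlib

open scoped Classical in
/-- The probability of the event `E` under the weights `p` on the finite sample space `Ω`. -/
noncomputable def prob {Ω : Type*} [Fintype Ω] (p : Ω → ℝ) (E : Ω → Prop) : ℝ :=
  ∑ ω with E ω, p ω

open scoped Classical in
/-- Shannon entropy `H(A)`, in bits, of a random variable `A` on a finite sample space;
`Real.negMulLog t = - t * Real.log t` uses the convention `0 log 0 = 0`. -/
noncomputable def entropy {Ω α : Type*} [Fintype Ω] (p : Ω → ℝ) (A : Ω → α) : ℝ :=
  ∑ a ∈ Finset.univ.image A, Real.negMulLog (prob p fun ω => A ω = a) / Real.log 2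

/-- Conditional entropy `H(A | B) = H(A, B) - H(B)`. -/
noncomputable def condEntropy {Ω α β : Type*} [Fintype Ω] (p : Ω → ℝ)
    (A : Ω → α) (B : Ω → β) : ℝ :=
  entropy p (fun ω => (A ω, B ω)) - entropy p B

/-- Conditional mutual information `I(A ; B | C) = H(A | C) - H(A | B, C)`. -/
noncomputable def condMutualInfo {Ω α β γ : Type*} [Fintype Ω] (p : Ω → ℝ)
    (A : Ω → α) (B : Ω → β) (C : Ω → γ) : ℝ :=
  condEntropy p A C - condEntropy p A fun ω => (B ω, C ω)

/-- Binary entropy to base `2`, `h(x) = - x log x - (1 - x) log (1 - x)`. -/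
noncomputable def binEnt (x : ℝ) : ℝ := Real.binEntropy x / Real.log 2

/-- The monotone version of binary entropy, `x ↦ h(min(x, 1/2))`. -/
noncomputable def binEntMono (x : ℝ) : ℝ := binEnt (min x (1 / 2))

/-- Deterministic two-party protocol trees. Alice sees a value in `A`, Bob sees a value in `B`.
A leaf carries the output both players agree on; at an inner node the player who owns it sends one
bit, a function of what this player sees, and the protocol moves to the corresponding child. -/
inductive ProtocolTree (A B Z : Type*) where
  | leaf (output : Z) : ProtocolTree A B Z
  | alice (msg : A → Bool) (next : Bool → ProtocolTree A B Z) : ProtocolTree A B Z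
  | bob (msg : B → Bool) (next : Bool → ProtocolTree A B Z) : ProtocolTree A B Z

namespace ProtocolTree

variable {A B Z : Type*}

/-- The list of transmitted bits. -/
def bits : ProtocolTree A B Z → A → B → List Bool
  | leaf _, _, _ => []
  | alice msg next, a, b => msg a :: (next (msg a)).bits a b
  | bob msg next, a, b => msg b :: (next (msg b)).bits a b

/-- The output of the protocol, i.e. the label of the leaf that is reached. -/
def output : ProtocolTree A B Z → A → B → Z
  | leaf z, _, _ => z
  | alice msg next, a, b => (next (msg a)).output a b
  | bob msg next, a, b => (next (msg b)).output a b

end ProtocolTree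

/-- Randomized two-party protocols for inputs in `X × Y` and outputs in `Z`: a public random string
and a private random string for each player, each with an arbitrary distribution on an arbitrary
finite set, and, for each value of the public string, a protocol tree in which each player sees the own input and the own
private random string. -/
structure Protocol (X Y Z : Type*) where
  PublicString : Type
  AliceString : Type
  BobString : Type
  [publicFintype : Fintype PublicString]
  [aliceFintype : Fintype AliceString]
  [bobFintype : Fintype BobString]
  publicLaw : stdSimplex ℝ PublicString
  aliceLaw : stdSimplex ℝ AliceString
  bobLaw : stdSimplex ℝ BobString
  tree : PublicString → ProtocolTree (X × AliceString) (Y × BobString) Z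

attribute [instance] Protocol.publicFintype Protocol.aliceFintype Protocol.bobFintype

namespace Protocol

variable {X Y Z : Type*}

/-- Sample space of an execution: inputs, public string, private string of Alice and of Bob. -/
abbrev Sample (π : Protocol X Y Z) : Type _ :=
  (X × Y) × π.PublicString × π.AliceString × π.BobString

/-- Inputs drawn from `μ`; inputs and the three random strings are independent. -/
def law [Fintype X] [Fintype Y] (π : Protocol X Y Z) (μ : stdSimplex ℝ (X × Y)) :
    π.Sample → ℝ :=
  fun ω => μ ω.1 * (π.publicLaw ω.2.1 * (π.aliceLaw ω.2.2.1 * π.bobLaw ω.2.2.2))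

/-- Alice's input. -/
def inputX (π : Protocol X Y Z) : π.Sample → X := fun ω => ω.1.1

/-- Bob's input. -/
def inputY (π : Protocol X Y Z) : π.Sample → Y := fun ω => ω.1.2

/-- The transcript: the public random string together with the transmitted bits. -/
def transcript (π : Protocol X Y Z) : π.Sample → π.PublicString × List Bool :=
  fun ω => (ω.2.1, (π.tree ω.2.1).bits (ω.1.1, ω.2.2.1) (ω.1.2, ω.2.2.2))

/-- The output of the protocol. -/
def output (π : Protocol X Y Z) : π.Sample → Z :=
  fun ω => (π.tree ω.2.1).output (ω.1.1, ω.2.2.1) (ω.1.2, ω.2.2.2)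

/-- Internal information cost `IC_μ(π) = I(Π ; X | Y) + I(Π ; Y | X)`. -/
noncomputable def infoCost [Fintype X] [Fintype Y] (π : Protocol X Y Z)
    (μ : stdSimplex ℝ (X × Y)) : ℝ :=
  condMutualInfo (π.law μ) π.transcript π.inputX π.inputY +
    condMutualInfo (π.law μ) π.transcript π.inputY π.inputX

/-- The protocol performs the task `[f, ν, ε]`: if the input is drawn from `ν`, the output differs
from the value of `f` with probability at most `ε`. -/
def Performs [Fintype X] [Fintype Y] (π : Protocol X Y Z) (f : X × Y → Z)
    (ν : stdSimplex ℝ (X × Y)) (ε : ℝ) : Prop :=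
  prob (π.law ν) (fun ω => π.output ω ≠ f (π.inputX ω, π.inputY ω)) ≤ ε

end Protocol

/-- Information complexity `IC_μ(f, ν, ε)` of the task `[f, ν, ε]` with respect to `μ`. -/
noncomputable def infoComplexity {X Y Z : Type*} [Fintype X] [Fintype Y]
    (μ : stdSimplex ℝ (X × Y)) (f : X × Y → Z) (ν : stdSimplex ℝ (X × Y)) (ε : ℝ) : ℝ :=
  sInf {c : ℝ | ∃ π : Protocol X Y Z, π.Performs f ν ε ∧ π.infoCost μ = c}

/-- Max-distributional information complexity `ICD(f, ε)`, the maximum (as a supremum) over all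
input distributions `μ` of `IC_μ(f, μ, ε)`. -/
noncomputable def maxDistInfoComplexity {X Y Z : Type*} [Fintype X] [Fintype Y]
    (f : X × Y → Z) (ε : ℝ) : ℝ :=
  ⨆ μ : stdSimplex ℝ (X × Y), infoComplexity μ f μ ε

/-! Removing errors. Conditioned on the inputs and `R`, the probability of the bits `l` factors as
`q(x) r(y)`, because the inputs leading to `l` form a rectangle. After a run with error `ε`, look at
the pairs in the support of `μ` on which the label of `l` is wrong. In each, the member with the
smaller normalized weight, `q(x)/Q` or `r(y)/R`, is put under doubt. That weight is at most the
geometric mean of the two, so by AM-GM the total probability of doubt is `O(√ε)`. The players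
announce whether their inputs are under doubt, and if one is, they exchange inputs. The error on the
support vanishes, and the additions to the transcript are determined by a variable that is constant
outside an event of probability `O(√ε)`, so they cost `O(h(√ε))` (`prob_doubt_le`,
`infoCost_recheck_le`, `infoComplexity_zero_le`). The constant involves `1/μ`, so the argument needs
one fixed `μ`: the maximizer.

Exploiting errors. Let `f(x₁, y₀) ≠ f(x₀, y₀)`. Alice privately applies the transposition of `x₀`
and `x₁` to her input `X` with probability `ε`, giving `X'`, and a zero-error protocol is run on
`(X', Y)`. The error on `μ` is at most `ε`. The transcript and `(X, Y)` determine whether `(X', Y) =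
(x₀, y₀)`; this is information about the private coin, not about the inputs, so at least `μ(x₀, y₀)
h(ε)` of the cost is saved (`condMutualInfo_add_le_of_noise`, `infoCost_noisy_add_le`). If `μ` has
little mass on inputs where one player can change the value, there is no such gain, but then the
zero-error cost is at most `1/2`, whereas `ICD(f, 0) ≥ 1`. -/

/-! ### Probability and Shannon entropy on finite sample spaces -/

section FiniteProbability

open scoped Classical

variable {Ω Ω' α β γ : Type*} [Fintype Ω] [Fintype Ω'] {p : Ω → ℝ}

theorem prob_nonneg (hp : ∀ ω, 0 ≤ p ω) (E : Ω → Prop) : 0 ≤ prob p E :=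
  Finset.sum_nonneg fun ω _ => hp ω

theorem prob_eq_sum_ite (p : Ω → ℝ) (E : Ω → Prop) :
    prob p E = ∑ ω, p ω * (if E ω then 1 else 0) := by
  simp [prob, Finset.sum_filter]

theorem prob_mono (hp : ∀ ω, 0 ≤ p ω) {E F : Ω → Prop}
    (h : ∀ ω, p ω ≠ 0 → E ω → F ω) : prob p E ≤ prob p F := by
  rw [prob_eq_sum_ite, prob_eq_sum_ite]
  refine Finset.sum_le_sum fun ω _ => ?_
  by_cases h0 : p ω = 0
  · simp [h0]
  · have := h ω h0
    have := hp ω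
    split_ifs <;> simp_all

theorem le_prob (hp : ∀ ω, 0 ≤ p ω) {E : Ω → Prop} {ω : Ω} (h : E ω) : p ω ≤ prob p E :=
  Finset.single_le_sum (f := p) (fun ω _ => hp ω) (by simpa using h)

theorem prob_pos (hp : ∀ ω, 0 ≤ p ω) {E : Ω → Prop} {ω : Ω} (h0 : p ω ≠ 0) (h : E ω) :
    0 < prob p E :=
  ((hp ω).lt_of_ne' h0).trans_le (le_prob hp h)

theorem sum_prob_and (p : Ω → ℝ) (A : Ω → α) (E : Ω → Prop) {S : Finset α}
    (hS : ∀ ω, A ω ∈ S) : ∑ a ∈ S, prob p (fun ω => A ω = a ∧ E ω) = prob p E := by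
  simp only [prob_eq_sum_ite]
  rw [Finset.sum_comm]
  refine Finset.sum_congr rfl fun ω _ => ?_
  rw [← Finset.mul_sum]
  congr 1
  by_cases h : E ω <;> simp [h, hS ω]

theorem sum_prob (p : Ω → ℝ) (A : Ω → α) {S : Finset α}
    (hS : ∀ ω, A ω ∈ S) : ∑ a ∈ S, prob p (fun ω => A ω = a) = ∑ ω, p ω := by
  have := sum_prob_and p A (fun _ => True) hS
  simpa [prob] using this

theorem sum_comp_eq_sum_prob (p : Ω → ℝ) (A : Ω → α) (φ : α → ℝ) {S : Finset α}
    (hS : ∀ ω, A ω ∈ S) : ∑ ω, p ω * φ (A ω) = ∑ a ∈ S, prob p (fun ω => A ω = a) * φ a := by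
  simp only [prob_eq_sum_ite, Finset.sum_mul]
  rw [Finset.sum_comm]
  refine Finset.sum_congr rfl fun ω _ => ?_
  simp [hS ω, ite_mul]

theorem entropy_eq_sum_of_subset (p : Ω → ℝ) (A : Ω → α) {S : Finset α} (hS : ∀ ω, A ω ∈ S) :
    entropy p A = ∑ a ∈ S, Real.negMulLog (prob p fun ω => A ω = a) / Real.log 2 := by
  unfold entropy
  refine Finset.sum_subset (fun a ha => ?_) fun a _ ha => ?_
  · obtain ⟨ω, -, rfl⟩ := Finset.mem_image.1 ha
    exact hS ω
  · have : prob p (fun ω => A ω = a) = 0 := by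
      refine Finset.sum_eq_zero fun ω hω => ?_
      exact absurd (Finset.mem_image.2 ⟨ω, Finset.mem_univ _, (Finset.mem_filter.1 hω).2⟩) ha
    simp [this]

/-- As an expectation over `Ω`, entropies of variables with different ranges can be compared sample
by sample. -/
theorem entropy_eq_sum (p : Ω → ℝ) (A : Ω → α) :
    entropy p A = ∑ ω, p ω * (-Real.log (prob p fun ω' => A ω' = A ω) / Real.log 2) := by
  rw [sum_comp_eq_sum_prob p A (fun a => -Real.log (prob p fun ω' => A ω' = a) / Real.log 2)
    (S := Finset.univ.image A) (by simp)]
  refine Finset.sum_congr rfl fun a _ => ?_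
  simp only [Real.negMulLog]
  ring

theorem log_two_pos : 0 < Real.log 2 := Real.log_pos one_lt_two

/-- A random variable that is almost surely a function of another one has smaller entropy. -/
theorem entropy_le_of_determined (hp : ∀ ω, 0 ≤ p ω) {A : Ω → α} {B : Ω → β}
    (h : ∀ ω ω', p ω ≠ 0 → p ω' ≠ 0 → B ω = B ω' → A ω = A ω') :
    entropy p A ≤ entropy p B := by
  rw [entropy_eq_sum, entropy_eq_sum]
  refine Finset.sum_le_sum fun ω _ => ?_
  by_cases h0 : p ω = 0
  · simp [h0]
  refine mul_le_mul_of_nonneg_left ?_ (hp ω)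
  refine div_le_div_of_nonneg_right (neg_le_neg ?_) log_two_pos.le
  refine Real.log_le_log (prob_pos hp h0 rfl) (prob_mono hp fun ω' h0' hB => ?_)
  exact h ω' ω h0' h0 hB

theorem entropy_congr (hp : ∀ ω, 0 ≤ p ω) {A : Ω → α} {B : Ω → β}
    (h : ∀ ω ω', p ω ≠ 0 → p ω' ≠ 0 → (A ω = A ω' ↔ B ω = B ω')) :
    entropy p A = entropy p B :=
  le_antisymm (entropy_le_of_determined hp fun ω ω' h0 h0' => (h ω ω' h0 h0').2)
    (entropy_le_of_determined hp fun ω ω' h0 h0' => (h ω ω' h0 h0').1)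

theorem entropy_const (hp1 : ∑ ω, p ω = 1) (b : β) : entropy p (fun _ => b) = 0 := by
  rw [entropy_eq_sum]
  simp [prob, hp1]

theorem entropy_nonneg (hp : ∀ ω, 0 ≤ p ω) (hp1 : ∑ ω, p ω = 1) (A : Ω → α) :
    0 ≤ entropy p A := by
  rw [← entropy_const hp1 ()]
  exact entropy_le_of_determined hp fun _ _ _ _ _ => rfl

/-- Strong subadditivity of Shannon entropy. -/
theorem entropy_submodular (hp : ∀ ω, 0 ≤ p ω) (A : Ω → α) (B : Ω → β) (C : Ω → γ) :
    entropy p (fun ω => (A ω, B ω, C ω)) + entropy p C ≤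
      entropy p (fun ω => (A ω, C ω)) + entropy p (fun ω => (B ω, C ω)) := by
  set PA := fun (a : α) (c : γ) => prob p (fun ω => A ω = a ∧ C ω = c) with hPA
  set PB := fun (b : β) (c : γ) => prob p (fun ω => B ω = b ∧ C ω = c) with hPB
  set PC := fun (c : γ) => prob p (fun ω => C ω = c) with hPC
  set PJ := fun (k : α × β × γ) => prob p (fun ω => (A ω, B ω, C ω) = k) with hPJ
  -- `φ` is the law under which `A` and `B` are conditionally independent given `C`. Its total mass
  -- equals that of `p`, and `log t ≤ t - 1` for `t = φ / PJ` gives nonnegativity of the relative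
  -- entropy.
  set φ := fun (k : α × β × γ) => PA k.1 k.2.2 * PB k.2.1 k.2.2 / PC k.2.2 with hφ
  have hPA0 : ∀ a c, 0 ≤ PA a c := fun a c => prob_nonneg hp _
  have hPB0 : ∀ a c, 0 ≤ PB a c := fun a c => prob_nonneg hp _
  have hPC0 : ∀ c, 0 ≤ PC c := fun c => prob_nonneg hp _
  have hPJ0 : ∀ c, 0 ≤ PJ c := fun c => prob_nonneg hp _
  have hφ0 : ∀ k, 0 ≤ φ k := fun k =>
    div_nonneg (mul_nonneg (hPA0 _ _) (hPB0 _ _)) (hPC0 _)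
  have key : ∑ ω, p ω * (φ (A ω, B ω, C ω) / PJ (A ω, B ω, C ω)) ≤ ∑ ω, p ω := by
    rw [sum_comp_eq_sum_prob p (fun ω => (A ω, B ω, C ω)) (fun k => φ k / PJ k)
      (S := Finset.univ.image A ×ˢ Finset.univ.image B ×ˢ Finset.univ.image C) (by simp)]
    calc _ ≤ ∑ k ∈ Finset.univ.image A ×ˢ Finset.univ.image B ×ˢ Finset.univ.image C, φ k := by
          refine Finset.sum_le_sum fun k _ => ?_
          change PJ k * (φ k / PJ k) ≤ φ k
          by_cases h : PJ k = 0
          · simp [h, hφ0]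
          · rw [mul_div_cancel₀ _ h]
      _ = ∑ c ∈ Finset.univ.image C, (∑ a ∈ Finset.univ.image A, PA a c) *
            (∑ b ∈ Finset.univ.image B, PB b c) / PC c := by
          rw [Finset.sum_product]
          simp_rw [Finset.sum_product]
          simp_rw [Finset.sum_comm (s := Finset.univ.image B)]
          rw [Finset.sum_comm]
          refine Finset.sum_congr rfl fun c _ => ?_
          rw [Finset.sum_mul_sum, Finset.sum_div]
          refine Finset.sum_congr rfl fun a _ => ?_
          rw [Finset.sum_div]
      _ = ∑ c ∈ Finset.univ.image C, PC c := by
          refine Finset.sum_congr rfl fun c _ => ?_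
          have h1 : ∑ a ∈ Finset.univ.image A, PA a c = PC c :=
            sum_prob_and p A (fun ω => C ω = c) (by simp)
          have h2 : ∑ b ∈ Finset.univ.image B, PB b c = PC c :=
            sum_prob_and p B (fun ω => C ω = c) (by simp)
          rw [h1, h2, mul_self_div_self]
      _ = ∑ ω, p ω := sum_prob p C (by simp)
  have hterm : ∀ ω, p ω * (-Real.log (PJ (A ω, B ω, C ω)) - Real.log (PC (C ω))
      + Real.log (PA (A ω) (C ω)) + Real.log (PB (B ω) (C ω))) ≤
        p ω * (φ (A ω, B ω, C ω) / PJ (A ω, B ω, C ω)) - p ω := by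
    intro ω
    by_cases h0 : p ω = 0
    · simp [h0]
    have h1 : 0 < PJ (A ω, B ω, C ω) := prob_pos hp h0 rfl
    have h2 : 0 < PC (C ω) := prob_pos hp h0 rfl
    have h3 : 0 < PA (A ω) (C ω) := prob_pos hp h0 ⟨rfl, rfl⟩
    have h4 : 0 < PB (B ω) (C ω) := prob_pos hp h0 ⟨rfl, rfl⟩
    have h5 : 0 < φ (A ω, B ω, C ω) / PJ (A ω, B ω, C ω) := by
      simp only [hφ]; positivity
    have h6 := Real.log_le_sub_one_of_pos h5
    have h7 : Real.log (φ (A ω, B ω, C ω) / PJ (A ω, B ω, C ω)) =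
        -Real.log (PJ (A ω, B ω, C ω)) - Real.log (PC (C ω))
      + Real.log (PA (A ω) (C ω)) + Real.log (PB (B ω) (C ω)) := by
      simp only [hφ]
      rw [Real.log_div (by positivity) h1.ne', Real.log_div (by positivity) h2.ne',
        Real.log_mul h3.ne' h4.ne']
      ring
    rw [← h7]
    nlinarith [mul_le_mul_of_nonneg_left h6 (hp ω)]
  have hsum := Finset.sum_le_sum fun ω (_ : ω ∈ Finset.univ) => hterm ω
  rw [Finset.sum_sub_distrib] at hsum
  have hsum0 := hsum.trans (sub_nonpos.2 key)
  rw [← sub_nonpos]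
  simp only [entropy_eq_sum]
  rw [← Finset.sum_add_distrib, ← Finset.sum_add_distrib, ← Finset.sum_sub_distrib]
  have : ∀ ω, p ω * (-Real.log (prob p fun ω' => (A ω', B ω', C ω') = (A ω, B ω, C ω)) /
        Real.log 2) + p ω * (-Real.log (prob p fun ω' => C ω' = C ω) / Real.log 2) -
      (p ω * (-Real.log (prob p fun ω' => (A ω', C ω') = (A ω, C ω)) / Real.log 2) +
        p ω * (-Real.log (prob p fun ω' => (B ω', C ω') = (B ω, C ω)) / Real.log 2)) =
      (p ω * (-Real.log (PJ (A ω, B ω, C ω)) - Real.log (PC (C ω))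
      + Real.log (PA (A ω) (C ω)) + Real.log (PB (B ω) (C ω)))) / Real.log 2 := by
    intro ω
    simp only [hPJ, hPC, hPA, hPB, Prod.mk.injEq]
    ring
  simp_rw [this]
  rw [← Finset.sum_div]
  exact div_nonpos_of_nonpos_of_nonneg hsum0 log_two_pos.le

theorem entropy_prod_le_add (hp : ∀ ω, 0 ≤ p ω) (hp1 : ∑ ω, p ω = 1) (A : Ω → α) (B : Ω → β) :
    entropy p (fun ω => (A ω, B ω)) ≤ entropy p A + entropy p B := by
  have h := entropy_submodular hp A B (fun _ => ())
  rw [entropy_const hp1,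
    entropy_congr (B := fun ω => (A ω, B ω)) hp (by intros; simp),
    entropy_congr (A := fun ω => (A ω, ())) (B := A) hp (by intros; simp),
    entropy_congr (A := fun ω => (B ω, ())) (B := B) hp (by intros; simp)] at h
  linarith

/-- Entropy depends only on the law: it may be computed after a measure preserving map. -/
theorem entropy_comp {p' : Ω' → ℝ} {g : Ω' → Ω}
    (hg : ∀ φ : Ω → ℝ, ∑ ω, p' ω * φ (g ω) = ∑ ω, p ω * φ ω) (A : Ω → α) :
    entropy p' (fun ω => A (g ω)) = entropy p A := by
  rw [entropy_eq_sum_of_subset p' (S := Finset.univ.image A) _ (by simp),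
    entropy_eq_sum_of_subset p (S := Finset.univ.image A) _ (by simp)]
  refine Finset.sum_congr rfl fun a _ => ?_
  rw [prob_eq_sum_ite, prob_eq_sum_ite, hg fun ω => if A ω = a then 1 else 0]

/-- Chain rule for independent sources: if `T` is a function of `V` and of a second coordinate that
is independent of `V`, then `H(T, V) = H(V) + E H(T | V = v)`. -/
theorem entropy_prod_indep {p₁ : Ω → ℝ} {p₂ : Ω' → ℝ} (h₁ : ∀ ω, 0 ≤ p₁ ω) (h₂ : ∀ ω, 0 ≤ p₂ ω)
    (h₂' : ∑ ω, p₂ ω = 1) (V : Ω → α) (F : α → Ω' → β) :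
    entropy (fun ω : Ω × Ω' => p₁ ω.1 * p₂ ω.2) (fun ω => (F (V ω.1) ω.2, V ω.1)) =
      entropy p₁ V + ∑ ω, p₁ ω * entropy p₂ (F (V ω)) := by
  simp only [entropy_eq_sum, Fintype.sum_prod_type, Finset.mul_sum]
  rw [← Finset.sum_add_distrib]
  refine Finset.sum_congr rfl fun ω _ => ?_
  have h3 : p₁ ω * (-Real.log (prob p₁ fun ω' => V ω' = V ω) / Real.log 2) =
      ∑ ω', p₁ ω * p₂ ω' * (-Real.log (prob p₁ fun ω' => V ω' = V ω) / Real.log 2) := by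
    rw [← Finset.sum_mul, ← Finset.mul_sum, h₂', mul_one]
  rw [h3, ← Finset.sum_add_distrib]
  refine Finset.sum_congr rfl fun ω' _ => ?_
  by_cases h0 : p₁ ω = 0
  · simp [h0]
  by_cases h0' : p₂ ω' = 0
  · simp [h0']
  have h4 : prob (fun ω : Ω × Ω' => p₁ ω.1 * p₂ ω.2)
      (fun x => (F (V x.1) x.2, V x.1) = (F (V ω) ω', V ω)) =
      prob p₁ (fun ω' => V ω' = V ω) * prob p₂ (fun x => F (V ω) x = F (V ω) ω') := by
    simp only [prob_eq_sum_ite, Fintype.sum_prod_type, Finset.sum_mul_sum]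
    refine Finset.sum_congr rfl fun x _ => Finset.sum_congr rfl fun x' _ => ?_
    by_cases hx : V x = V ω
    · simp [hx]
    · simp [hx]
  rw [h4, Real.log_mul (prob_pos (E := fun x => V x = V ω) h₁ h0 rfl).ne'
    (prob_pos (E := fun x => F (V ω) x = F (V ω) ω') h₂ h0' rfl).ne']
  ring

end FiniteProbability

/-! ### Inequalities for binary entropy -/

section BinaryEntropy

theorem binEnt_zero : binEnt 0 = 0 := by simp [binEnt]

theorem binEnt_half : binEnt (1 / 2) = 1 := by
  rw [binEnt, one_div, Real.binEntropy_two_inv, div_self log_two_pos.ne']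

theorem binEnt_eq (x : ℝ) :
    binEnt x = Real.negMulLog x / Real.log 2 + Real.negMulLog (1 - x) / Real.log 2 := by
  rw [binEnt, Real.binEntropy_eq_negMulLog_add_negMulLog_one_sub, add_div]

theorem binEnt_nonneg {x : ℝ} (h0 : 0 ≤ x) (h1 : x ≤ 1) : 0 ≤ binEnt x :=
  div_nonneg (Real.binEntropy_nonneg h0 h1) log_two_pos.le

theorem binEnt_le_one (x : ℝ) : binEnt x ≤ 1 :=
  (div_le_one log_two_pos).2 Real.binEntropy_le_log_two

theorem binEnt_mono {x y : ℝ} (h0 : 0 ≤ x) (hxy : x ≤ y) (hy : y ≤ 1 / 2) :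
    binEnt x ≤ binEnt y := by
  refine div_le_div_of_nonneg_right ?_ log_two_pos.le
  have h2 : (2 : ℝ)⁻¹ = 1 / 2 := by norm_num
  exact Real.binEntropy_strictMonoOn.monotoneOn ⟨h0, by linarith⟩ ⟨h0.trans hxy, by linarith⟩ hxy

theorem binEnt_le_binEntMono {x y : ℝ} (h0 : 0 ≤ x) (hxy : x ≤ y) :
    binEnt x ≤ binEntMono y := by
  unfold binEntMono
  rcases le_total y (1 / 2) with h | h
  · rw [min_eq_left h]
    exact binEnt_mono h0 hxy h
  · rw [min_eq_right h, binEnt_half]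
    exact binEnt_le_one x

theorem binEntMono_zero : binEntMono 0 = 0 := by simp [binEntMono, binEnt_zero]

/-- Concavity of `h` on the segment from `0`, together with `h(0) = 0`. -/
theorem mul_binEnt_le {s x : ℝ} (hs0 : 0 ≤ s) (hs1 : s ≤ 1) (h0 : 0 ≤ x) (h1 : x ≤ 1) :
    s * binEnt x ≤ binEnt (s * x) := by
  have h := Real.strictConcave_binEntropy.concaveOn.2 (x := x) ⟨h0, h1⟩ (y := 0) ⟨le_rfl, zero_le_one⟩
    hs0 (sub_nonneg.2 hs1) (by ring)
  simp only [smul_eq_mul, Real.binEntropy_zero, mul_zero, add_zero] at h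
  rw [binEnt, binEnt, ← mul_div_assoc]
  exact div_le_div_of_nonneg_right h log_two_pos.le

/-- Serves to pull the constant out of `h̃(K √ε)`; it is `mul_binEnt_le` with `s = 1/K`. -/
theorem binEntMono_mul_le {K x : ℝ} (hK : 1 ≤ K) (h0 : 0 ≤ x) :
    binEntMono (K * x) ≤ K * binEntMono x := by
  have hK0 : 0 < K := by linarith
  have hm := mul_binEnt_le (s := K⁻¹) (x := min (K * x) (1 / 2)) (by positivity) (inv_le_one_of_one_le₀ hK)
    (le_min (by positivity) (by norm_num)) ((min_le_right _ _).trans (by norm_num))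
  have h2 : binEnt (K⁻¹ * min (K * x) (1 / 2)) ≤ binEntMono x := by
    refine binEnt_le_binEntMono ?_ ?_
    · exact mul_nonneg (by positivity) (le_min (by positivity) (by norm_num))
    · rw [inv_mul_le_iff₀ hK0]
      exact min_le_left _ _
  have := mul_le_mul_of_nonneg_left (hm.trans h2) hK0.le
  rwa [mul_inv_cancel_left₀ hK0.ne'] at this

/-- A concave function that vanishes at `0` is subadditive; here the function is `s ↦ -(1 - s) log
(1 - s)`. -/
theorem negMulLog_one_sub_add_le {a b : ℝ} (ha : 0 ≤ a) (hb : 0 ≤ b) (hab : a + b ≤ 1) :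
    Real.negMulLog (1 - (a + b)) ≤ Real.negMulLog (1 - a) + Real.negMulLog (1 - b) := by
  rcases (add_nonneg ha hb).eq_or_lt with h | h
  · have h1 : a = 0 := by linarith
    have h2 : b = 0 := by linarith
    simp [h1, h2]
  have key : ∀ s t : ℝ, 0 ≤ s → 0 ≤ t → s + t = a + b →
      s / (a + b) * Real.negMulLog (1 - (a + b)) ≤ Real.negMulLog (1 - s) := by
    intro s t hs ht hst
    have := Real.concaveOn_negMulLog.2 (show 1 - (a + b) ∈ Set.Ici (0 : ℝ) by simpa using hab)
      (show (1 : ℝ) ∈ Set.Ici (0 : ℝ) by simp) (show 0 ≤ s / (a + b) by positivity)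
      (show 0 ≤ t / (a + b) by positivity) (by rw [← add_div, hst, div_self h.ne'])
    simp only [smul_eq_mul, Real.negMulLog_one, mul_zero, add_zero, mul_one] at this
    have e : s / (a + b) * (1 - (a + b)) + t / (a + b) = 1 - s := by
      have := h.ne'
      field_simp
      linear_combination hst
    rwa [e] at this
  have h1 := key a b ha hb rfl
  have h2 := key b a hb ha (add_comm _ _)
  have h3 : a / (a + b) + b / (a + b) = 1 := by rw [← add_div, div_self h.ne']
  calc _ = (a / (a + b) + b / (a + b)) * Real.negMulLog (1 - (a + b)) := by rw [h3, one_mul]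
    _ ≤ _ := by rw [add_mul]; exact add_le_add h1 h2

theorem negMulLog_one_sub_sum_le {ι : Type*} (s : Finset ι) (x : ι → ℝ) (h0 : ∀ i ∈ s, 0 ≤ x i)
    (h1 : ∑ i ∈ s, x i ≤ 1) :
    Real.negMulLog (1 - ∑ i ∈ s, x i) ≤ ∑ i ∈ s, Real.negMulLog (1 - x i) := by
  classical
  induction s using Finset.induction_on with
  | empty => simp
  | insert a s ha ih =>
    rw [Finset.sum_insert ha] at h1 ⊢
    rw [Finset.sum_insert ha]
    have ha0 := h0 a (Finset.mem_insert_self a s)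
    have hs0 : 0 ≤ ∑ i ∈ s, x i :=
      Finset.sum_nonneg fun i hi => h0 i (Finset.mem_insert_of_mem hi)
    have := ih (fun i hi => h0 i (Finset.mem_insert_of_mem hi)) (by linarith)
    exact (negMulLog_one_sub_add_le ha0 hs0 h1).trans (by linarith)

end BinaryEntropy

/-! ### Inequalities for mutual information -/

section Information

variable {Ω α β γ δ : Type*} [Fintype Ω] {p : Ω → ℝ}

theorem prob_le_one (hp : ∀ ω, 0 ≤ p ω) (hp1 : ∑ ω, p ω = 1) (E : Ω → Prop) : prob p E ≤ 1 := by
  rw [← hp1]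
  exact Finset.sum_le_sum_of_subset_of_nonneg (Finset.subset_univ _) fun ω _ _ => hp ω

/-- The value `none` has probability one minus the sum of the others. By subadditivity its term
splits into the second halves of the binary entropies. -/
theorem entropy_option_le [Fintype α] (hp : ∀ ω, 0 ≤ p ω) (hp1 : ∑ ω, p ω = 1)
    (E : Ω → Option α) : entropy p E ≤ ∑ e, binEnt (prob p fun ω => E ω = some e) := by
  classical
  rw [entropy_eq_sum_of_subset p (S := Finset.univ) E (by simp), Fintype.sum_option]
  have h1 := sum_prob p E (S := Finset.univ) (by simp)
  rw [Fintype.sum_option, hp1] at h1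
  have h2 : prob p (fun ω => E ω = none) = 1 - ∑ e, prob p (fun ω => E ω = some e) := by linarith
  have h3 := negMulLog_one_sub_sum_le Finset.univ (fun e => prob p (fun ω => E ω = some e))
    (fun e _ => prob_nonneg hp _) (by linarith [prob_nonneg hp fun ω => E ω = none])
  rw [h2]
  simp_rw [binEnt_eq]
  rw [Finset.sum_add_distrib, add_comm, ← Finset.sum_div, ← Finset.sum_div]
  exact add_le_add le_rfl (div_le_div_of_nonneg_right h3 log_two_pos.le)

theorem entropy_option_le_binEntMono [Fintype α] (hp : ∀ ω, 0 ≤ p ω) (hp1 : ∑ ω, p ω = 1)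
    (E : Ω → Option α) {x : ℝ} (hx : prob p (fun ω => E ω ≠ none) ≤ x) :
    entropy p E ≤ Fintype.card α * binEntMono x := by
  refine (entropy_option_le hp hp1 E).trans ?_
  rw [← nsmul_eq_mul, ← Finset.card_univ]
  refine Finset.sum_le_card_nsmul _ _ _ fun e _ => ?_
  exact binEnt_le_binEntMono (prob_nonneg hp _)
    ((prob_mono hp fun ω _ h => by simp [h]).trans hx)

theorem condMutualInfo_nonneg (hp : ∀ ω, 0 ≤ p ω) (A : Ω → α) (B : Ω → β) (C : Ω → γ) :
    0 ≤ condMutualInfo p A B C := by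
  have := entropy_submodular hp A B C
  simp only [condMutualInfo, condEntropy]
  linarith

/-- Refining a variable `T` to `T'` by means of `E` adds at most `H(E)` to the information. -/
theorem condMutualInfo_le_add_entropy (hp : ∀ ω, 0 ≤ p ω) (hp1 : ∑ ω, p ω = 1)
    {T' : Ω → δ} {T : Ω → α} {ε : Type*} {E : Ω → ε}
    (h : ∀ ω ω', T ω = T ω' → E ω = E ω' → T' ω = T' ω') (h' : ∀ ω ω', T' ω = T' ω' → T ω = T ω')
    (B : Ω → β) (C : Ω → γ) :
    condMutualInfo p T' B C ≤ condMutualInfo p T B C + entropy p E := by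
  have h1 : entropy p (fun ω => (T' ω, C ω)) ≤ entropy p (fun ω => (E ω, T ω, C ω)) := by
    refine entropy_le_of_determined hp fun ω ω' _ _ hh => ?_
    simp only [Prod.mk.injEq] at hh ⊢
    exact ⟨h _ _ hh.2.1 hh.1, hh.2.2⟩
  have h2 := entropy_prod_le_add hp hp1 E (fun ω => (T ω, C ω))
  have h3 : entropy p (fun ω => (T ω, B ω, C ω)) ≤ entropy p (fun ω => (T' ω, B ω, C ω)) := by
    refine entropy_le_of_determined hp fun ω ω' _ _ hh => ?_
    simp only [Prod.mk.injEq] at hh ⊢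
    exact ⟨h' _ _ hh.1, hh.2⟩
  simp only [condMutualInfo, condEntropy]
  linarith

theorem condMutualInfo_le_entropy (hp : ∀ ω, 0 ≤ p ω) (hp1 : ∑ ω, p ω = 1)
    {T' : Ω → δ} {ε : Type*} {E : Ω → ε} (h : ∀ ω ω', E ω = E ω' → T' ω = T' ω')
    (B : Ω → β) (C : Ω → γ) : condMutualInfo p T' B C ≤ entropy p E := by
  have h1 := condMutualInfo_le_add_entropy hp hp1 (T := fun _ => ()) (fun ω ω' _ => h ω ω')
    (fun _ _ _ => rfl) B C
  have h2 : condMutualInfo p (fun _ => ()) B C = 0 := by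
    simp only [condMutualInfo, condEntropy]
    rw [entropy_congr (A := fun ω => ((), C ω)) (B := C) hp (by intros; simp),
      entropy_congr (A := fun ω => ((), B ω, C ω)) (B := fun ω => (B ω, C ω)) hp (by intros; simp)]
    ring
  linarith

/-- If `T` depends on `X` only through a noisy copy `X'` of `X`, then passing from `X'` to `X`
lowers the information cost by at least `H(W | X, Y)`, for `W` determined by `X'` and by `T`. -/
theorem condMutualInfo_add_le_of_noise (hp : ∀ ω, 0 ≤ p ω) {ζ : Type*}
    (T : Ω → δ) (X : Ω → α) (X' : Ω → β) (Y : Ω → γ) (W : Ω → ζ)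
    (hT : condEntropy p T (fun ω => (X ω, X' ω, Y ω)) = condEntropy p T (fun ω => (X' ω, Y ω)))
    (hX' : condEntropy p X' (fun ω => (X ω, Y ω)) = condEntropy p X' X)
    (hW : ∀ ω ω', X' ω = X' ω' → X ω = X ω' → Y ω = Y ω' → W ω = W ω')
    (hW' : ∀ ω ω', p ω ≠ 0 → p ω' ≠ 0 → T ω = T ω' → X ω = X ω' → Y ω = Y ω' → W ω = W ω') :
    condMutualInfo p T X Y + condMutualInfo p T Y X + condEntropy p W (fun ω => (X ω, Y ω)) ≤
      condMutualInfo p T X' Y + condMutualInfo p T Y X' := by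
  -- `s1` and `s2`, with `hT` and `hX'`, give `I(T;Y|X) ≤ I(T;Y|X,X') ≤ I(T;Y|X')`. By `hT`,
  -- `I(T;X'|Y) - I(T;X|Y) = I(T;X'|X,Y)`, and `s3` bounds this below by `H(W|X,Y)`, since given
  -- `(X, Y)` both `T` and `X'` determine `W`.
  have s1 := entropy_submodular hp Y X' (fun ω => (T ω, X ω))
  have s2 := entropy_submodular hp T X X'
  have s3 := entropy_submodular hp X' T (fun ω => (W ω, X ω, Y ω))
  have e1 : entropy p (fun ω => (Y ω, X' ω, T ω, X ω)) =
      entropy p (fun ω => (T ω, X ω, X' ω, Y ω)) :=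
    entropy_congr hp fun ω ω' _ _ => by simp only [Prod.mk.injEq]; tauto
  have e2 : entropy p (fun ω => (Y ω, T ω, X ω)) = entropy p (fun ω => (T ω, X ω, Y ω)) :=
    entropy_congr hp fun ω ω' _ _ => by simp only [Prod.mk.injEq]; tauto
  have e3 : entropy p (fun ω => (X' ω, T ω, X ω)) = entropy p (fun ω => (T ω, X ω, X' ω)) :=
    entropy_congr hp fun ω ω' _ _ => by simp only [Prod.mk.injEq]; tauto
  have e4 : entropy p (fun ω => (X' ω, X ω)) = entropy p (fun ω => (X ω, X' ω)) :=
    entropy_congr hp fun ω ω' _ _ => by simp only [Prod.mk.injEq]; tauto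
  have e5 : entropy p (fun ω => (X' ω, X ω, Y ω)) = entropy p (fun ω => (X ω, X' ω, Y ω)) :=
    entropy_congr hp fun ω ω' _ _ => by simp only [Prod.mk.injEq]; tauto
  have e6 : entropy p (fun ω => (X' ω, W ω, X ω, Y ω)) = entropy p (fun ω => (X ω, X' ω, Y ω)) :=
    entropy_congr hp fun ω ω' _ _ => by
      have := hW ω ω'
      simp only [Prod.mk.injEq]; tauto
  have e7 : entropy p (fun ω => (T ω, W ω, X ω, Y ω)) = entropy p (fun ω => (T ω, X ω, Y ω)) :=
    entropy_congr hp fun ω ω' h h' => by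
      have := hW' ω ω' h h'
      simp only [Prod.mk.injEq]; tauto
  have e8 : entropy p (fun ω => (X' ω, T ω, W ω, X ω, Y ω)) =
      entropy p (fun ω => (T ω, X ω, X' ω, Y ω)) :=
    entropy_congr hp fun ω ω' h h' => by
      have := hW' ω ω' h h'
      simp only [Prod.mk.injEq]; tauto
  have e9 : entropy p (fun ω => (T ω, Y ω, X ω)) = entropy p (fun ω => (T ω, X ω, Y ω)) :=
    entropy_congr hp fun ω ω' _ _ => by simp only [Prod.mk.injEq]; tauto
  have e10 : entropy p (fun ω => (Y ω, X ω)) = entropy p (fun ω => (X ω, Y ω)) :=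
    entropy_congr hp fun ω ω' _ _ => by simp only [Prod.mk.injEq]; tauto
  have e11 : entropy p (fun ω => (T ω, Y ω, X' ω)) = entropy p (fun ω => (T ω, X' ω, Y ω)) :=
    entropy_congr hp fun ω ω' _ _ => by simp only [Prod.mk.injEq]; tauto
  have e12 : entropy p (fun ω => (Y ω, X' ω)) = entropy p (fun ω => (X' ω, Y ω)) :=
    entropy_congr hp fun ω ω' _ _ => by simp only [Prod.mk.injEq]; tauto
  simp only [condMutualInfo, condEntropy] at hT hX' ⊢
  linarith

end Information

/-! ### Operations on protocol trees -/

namespace ProtocolTree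

variable {A B A' B' Z : Type*}

/-- The same tree, for players that see more. -/
def comap (g : A' → A) (h : B' → B) : ProtocolTree A B Z → ProtocolTree A' B' Z
  | leaf z => leaf z
  | alice msg next => alice (fun a => msg (g a)) fun c => (next c).comap g h
  | bob msg next => bob (fun b => msg (h b)) fun c => (next c).comap g h

theorem bits_comap (g : A' → A) (h : B' → B) (t : ProtocolTree A B Z) (a : A') (b : B') :
    (t.comap g h).bits a b = t.bits (g a) (h b) := by
  induction t with
  | leaf => rfl
  | alice msg next ih => simp [comap, bits, ih]
  | bob msg next ih => simp [comap, bits, ih]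

theorem output_comap (g : A' → A) (h : B' → B) (t : ProtocolTree A B Z) (a : A') (b : B') :
    (t.comap g h).output a b = t.output (g a) (h b) := by
  induction t with
  | leaf => rfl
  | alice msg next ih => simp [comap, output, ih]
  | bob msg next ih => simp [comap, output, ih]

/-- Continue, at the leaf reached after the bits `l`, with the tree `k l`. -/
def graft : ProtocolTree A B Z → (List Bool → ProtocolTree A B Z) → ProtocolTree A B Z
  | leaf _, k => k []
  | alice msg next, k => alice msg fun c => (next c).graft fun l => k (c :: l)
  | bob msg next, k => bob msg fun c => (next c).graft fun l => k (c :: l)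

theorem bits_graft (t : ProtocolTree A B Z) (k : List Bool → ProtocolTree A B Z) (a : A) (b : B) :
    (t.graft k).bits a b = t.bits a b ++ (k (t.bits a b)).bits a b := by
  induction t generalizing k with
  | leaf => rfl
  | alice msg next ih => simp [graft, bits, ih]
  | bob msg next ih => simp [graft, bits, ih]

theorem output_graft (t : ProtocolTree A B Z) (k : List Bool → ProtocolTree A B Z) (a : A)
    (b : B) : (t.graft k).output a b = (k (t.bits a b)).output a b := by
  induction t generalizing k with
  | leaf => rfl
  | alice msg next ih => simp [graft, bits, output, ih]
  | bob msg next ih => simp [graft, bits, output, ih]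

/-- The label of the leaf that is reached after the given bits. -/
def label : ProtocolTree A B Z → List Bool → Z
  | leaf z, _ => z
  | alice _ next, l => (next (l.headD false)).label l.tail
  | bob _ next, l => (next (l.headD false)).label l.tail

theorem label_bits (t : ProtocolTree A B Z) (a : A) (b : B) :
    t.label (t.bits a b) = t.output a b := by
  induction t with
  | leaf => rfl
  | alice msg next ih => simp [label, bits, output, ih]
  | bob msg next ih => simp [label, bits, output, ih]

/-- The inputs that lead to a given list of bits form a combinatorial rectangle. -/
theorem bits_eq_of_bits_eq (t : ProtocolTree A B Z) {a a' : A} {b b' : B} {l : List Bool}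
    (h : t.bits a b' = l) (h' : t.bits a' b = l) : t.bits a b = l := by
  induction t generalizing l with
  | leaf => exact h
  | alice msg next ih =>
    subst h
    simp only [bits, List.cons.injEq] at h' ⊢
    exact ⟨trivial, ih _ rfl (h'.1 ▸ h'.2)⟩
  | bob msg next ih =>
    subst h
    simp only [bits, List.cons.injEq] at h' ⊢
    exact ⟨h'.1, h'.1 ▸ ih _ rfl (h'.1 ▸ h'.2)⟩

/-- Transcripts of one tree are prefix-free, so the transcript of a grafted tree reveals that of the
original. -/
theorem bits_eq_of_append_eq (t : ProtocolTree A B Z) {a a' : A} {b b' : B} {l l' : List Bool}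
    (h : t.bits a b ++ l = t.bits a' b' ++ l') : t.bits a b = t.bits a' b' := by
  induction t with
  | leaf => rfl
  | alice msg next ih =>
    simp only [bits, List.cons_append, List.cons.injEq] at h ⊢
    exact ⟨h.1, h.1 ▸ ih (msg a) (h.1 ▸ h.2)⟩
  | bob msg next ih =>
    simp only [bits, List.cons_append, List.cons.injEq] at h ⊢
    exact ⟨h.1, h.1 ▸ ih (msg b) (h.1 ▸ h.2)⟩

-- Alice goes through a list of her possible inputs, answering for each whether it is hers, until
-- the answer is yes.
open scoped Classical in
theorem exists_alice_forall_output [Finite A] [Nonempty A] (F : A → ProtocolTree A B Z) :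
    ∃ t : ProtocolTree A B Z, ∀ a b, t.output a b = (F a).output a b := by
  cases nonempty_fintype A
  suffices h : ∀ l : List A, ∃ t : ProtocolTree A B Z, ∀ a ∈ l, ∀ b,
      t.output a b = (F a).output a b by
    obtain ⟨t, ht⟩ := h Finset.univ.toList
    exact ⟨t, fun a => ht a (by simp)⟩
  intro l
  induction l with
  | nil => exact ⟨F (Classical.arbitrary A), by simp⟩
  | cons a₀ l ih =>
    obtain ⟨t, ht⟩ := ih
    refine ⟨alice (fun a => decide (a = a₀)) fun c => if c then F a₀ else t, fun a ha b => ?_⟩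
    by_cases h : a = a₀
    · simp [output, h]
    · simp only [output, h, decide_false, Bool.false_eq_true, if_false]
      exact ht a ((List.mem_cons.1 ha).resolve_left h) b

open scoped Classical in
theorem exists_bob_forall_output [Finite B] [Nonempty B] (F : B → ProtocolTree A B Z) :
    ∃ t : ProtocolTree A B Z, ∀ a b, t.output a b = (F b).output a b := by
  cases nonempty_fintype B
  suffices h : ∀ l : List B, ∃ t : ProtocolTree A B Z, ∀ a, ∀ b ∈ l,
      t.output a b = (F b).output a b by
    obtain ⟨t, ht⟩ := h Finset.univ.toList
    exact ⟨t, fun a b => ht a b (by simp)⟩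
  intro l
  induction l with
  | nil => exact ⟨F (Classical.arbitrary B), by simp⟩
  | cons b₀ l ih =>
    obtain ⟨t, ht⟩ := ih
    refine ⟨bob (fun b => decide (b = b₀)) fun c => if c then F b₀ else t, fun a b hb => ?_⟩
    by_cases h : b = b₀
    · simp [output, h]
    · simp only [output, h, decide_false, Bool.false_eq_true, if_false]
      exact ht a b ((List.mem_cons.1 hb).resolve_left h)

/-- Every function is computed by the players exchanging their inputs. -/
theorem exists_forall_output_eq [Finite A] [Nonempty A] [Finite B] [Nonempty B] (f : A × B → Z) :
    ∃ t : ProtocolTree A B Z, ∀ a b, t.output a b = f (a, b) := by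
  choose F hF using fun a => exists_bob_forall_output (A := A) fun b => leaf (f (a, b))
  obtain ⟨t, ht⟩ := exists_alice_forall_output F
  exact ⟨t, fun a b => by rw [ht, hF]; rfl⟩

open scoped Classical in
/-- Alice says whether her input is in `S`, then Bob says whether his is in `T`; as soon as the
answer is yes they continue with `D`, and otherwise they output `z`. -/
noncomputable def check (S : Set A) (T : Set B) (z : Z) (D : ProtocolTree A B Z) :
    ProtocolTree A B Z :=
  alice (fun a => decide (a ∈ S)) fun c =>
    if c then D else bob (fun b => decide (b ∈ T)) fun c' => if c' then D else leaf z

theorem output_check_of_mem {S : Set A} {T : Set B} (z : Z) (D : ProtocolTree A B Z) {a : A} {b : B}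
    (h : a ∈ S ∨ b ∈ T) : (check S T z D).output a b = D.output a b := by
  by_cases ha : a ∈ S
  · simp [check, output, ha]
  · simp [check, output, ha, h.resolve_left ha]

theorem output_check_of_notMem {S : Set A} {T : Set B} (z : Z) (D : ProtocolTree A B Z) {a : A}
    {b : B} (h : ¬(a ∈ S ∨ b ∈ T)) : (check S T z D).output a b = z := by
  rw [not_or] at h
  simp [check, output, h.1, h.2]

theorem bits_check_of_notMem {S : Set A} {T : Set B} (z : Z) (D : ProtocolTree A B Z) {a : A}
    {b : B} (h : ¬(a ∈ S ∨ b ∈ T)) : (check S T z D).bits a b = [false, false] := by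
  rw [not_or] at h
  simp [check, bits, h.1, h.2]

end ProtocolTree

/-! ### Deterministic protocols and the law of an execution -/

namespace Protocol

variable {X Y Z : Type*}

/-- The protocol without randomness given by a tree. -/
def ofTree (t : ProtocolTree X Y Z) : Protocol X Y Z where
  PublicString := Unit
  AliceString := Unit
  BobString := Unit
  publicLaw := ⟨fun _ => 1, by simp [stdSimplex]⟩
  aliceLaw := ⟨fun _ => 1, by simp [stdSimplex]⟩
  bobLaw := ⟨fun _ => 1, by simp [stdSimplex]⟩
  tree _ := t.comap Prod.fst Prod.fst

theorem output_ofTree (t : ProtocolTree X Y Z) (ω : (ofTree t).Sample) :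
    (ofTree t).output ω = t.output ((ofTree t).inputX ω) ((ofTree t).inputY ω) :=
  ProtocolTree.output_comap _ _ _ _ _

theorem transcript_ofTree (t : ProtocolTree X Y Z) (ω : (ofTree t).Sample) :
    (ofTree t).transcript ω = ((), t.bits ω.1.1 ω.1.2) :=
  Prod.ext rfl (ProtocolTree.bits_comap _ _ _ _ _)

variable [Fintype X] [Fintype Y]

theorem law_nonneg (π : Protocol X Y Z) (μ : stdSimplex ℝ (X × Y)) (ω : π.Sample) :
    0 ≤ π.law μ ω :=
  mul_nonneg (μ.2.1 _) (mul_nonneg (π.publicLaw.2.1 _)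
    (mul_nonneg (π.aliceLaw.2.1 _) (π.bobLaw.2.1 _)))

theorem sum_law_mul (π : Protocol X Y Z) (μ : stdSimplex ℝ (X × Y)) (φ : π.Sample → ℝ) :
    ∑ ω, π.law μ ω * φ ω = ∑ q, μ q * ∑ r, π.publicLaw r * ∑ a, π.aliceLaw a *
      ∑ b, π.bobLaw b * φ (q, r, a, b) := by
  simp only [Fintype.sum_prod_type (α₁ := X × Y), Fintype.sum_prod_type (α₁ := π.PublicString),
    Fintype.sum_prod_type (α₁ := π.AliceString), law, Finset.mul_sum, mul_assoc]

theorem sum_law (π : Protocol X Y Z) (μ : stdSimplex ℝ (X × Y)) : ∑ ω, π.law μ ω = 1 := by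
  have h := π.sum_law_mul μ fun _ => 1
  have h1 : ∑ q, μ q = 1 := μ.2.2
  have h2 : ∑ q, π.publicLaw q = 1 := π.publicLaw.2.2
  have h3 : ∑ q, π.aliceLaw q = 1 := π.aliceLaw.2.2
  have h4 : ∑ q, π.bobLaw q = 1 := π.bobLaw.2.2
  simpa [h1, h2, h3, h4] using h

theorem infoCost_nonneg (π : Protocol X Y Z) (μ : stdSimplex ℝ (X × Y)) : 0 ≤ π.infoCost μ :=
  add_nonneg (condMutualInfo_nonneg (π.law_nonneg μ) _ _ _)
    (condMutualInfo_nonneg (π.law_nonneg μ) _ _ _)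

theorem infoCost_le_entropy (π : Protocol X Y Z) (μ : stdSimplex ℝ (X × Y)) {α : Type*}
    {E : π.Sample → α} (h : ∀ ω ω', E ω = E ω' → π.transcript ω = π.transcript ω') :
    π.infoCost μ ≤ 2 * entropy (π.law μ) E := by
  have h1 := condMutualInfo_le_entropy (π.law_nonneg μ) (π.sum_law μ) h π.inputX π.inputY
  have h2 := condMutualInfo_le_entropy (π.law_nonneg μ) (π.sum_law μ) h π.inputY π.inputX
  unfold infoCost
  linarith

theorem Performs.mono {π : Protocol X Y Z} {f : X × Y → Z} {ν : stdSimplex ℝ (X × Y)} {ε ε' : ℝ}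
    (h : π.Performs f ν ε) (hε : ε ≤ ε') : π.Performs f ν ε' :=
  le_trans h hε

theorem performs_of_forall {π : Protocol X Y Z} {f : X × Y → Z} {ν : stdSimplex ℝ (X × Y)} {ε : ℝ}
    (hε : 0 ≤ ε)
    (h : ∀ ω, π.law ν ω ≠ 0 → π.output ω = f (π.inputX ω, π.inputY ω)) : π.Performs f ν ε := by
  refine (prob_mono (F := fun _ => False) (π.law_nonneg ν) fun ω h0 hne => hne (h ω h0)).trans ?_
  simpa [prob] using hε

theorem prob_ofTree (t : ProtocolTree X Y Z) (μ : stdSimplex ℝ (X × Y)) (E : X × Y → Prop) :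
    prob ((ofTree t).law μ) (fun ω => E ω.1) = prob (fun q => μ q) E := by
  rw [prob_eq_sum_ite, prob_eq_sum_ite, sum_law_mul]
  refine Finset.sum_congr rfl fun q _ => ?_
  congr 1
  change ∑ _ : Unit, (1 : ℝ) * ∑ _ : Unit, (1 : ℝ) * ∑ _ : Unit, (1 : ℝ) * _ = _
  simp only [Finset.univ_unique, Finset.sum_singleton, one_mul]

end Protocol

/-! ### Information complexity as a well-behaved infimum and supremum -/

section Complexity

variable {X Y Z : Type*} [Fintype X] [Fintype Y] {f : X × Y → Z}

theorem nonempty_of_stdSimplex (μ : stdSimplex ℝ (X × Y)) : Nonempty (X × Y) := by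
  by_contra h
  rw [not_nonempty_iff] at h
  have : ∑ q, μ q = 1 := μ.2.2
  simp at this

/-- Exchanging the inputs makes the set in the infimum nonempty and bounds the supremum over `μ`;
without this, `sInf` and `⨆` could be default values. -/
theorem exists_performs_zero (f : X × Y → Z) (μ : stdSimplex ℝ (X × Y)) :
    ∃ π : Protocol X Y Z, π.Performs f μ 0 ∧ π.infoCost μ ≤ 2 * Fintype.card (X × Y) := by
  obtain ⟨x, y⟩ := nonempty_of_stdSimplex μ
  have : Nonempty X := ⟨x⟩
  have : Nonempty Y := ⟨y⟩
  obtain ⟨D, hD⟩ := ProtocolTree.exists_forall_output_eq f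
  refine ⟨Protocol.ofTree D, Protocol.performs_of_forall le_rfl fun ω _ => ?_, ?_⟩
  · rw [Protocol.output_ofTree, hD]
  · refine ((Protocol.ofTree D).infoCost_le_entropy μ (E := fun ω => some ω.1)
      fun ω ω' h => ?_).trans ?_
    · rw [Protocol.transcript_ofTree, Protocol.transcript_ofTree, Option.some.inj h]
    · refine mul_le_mul_of_nonneg_left ?_ zero_le_two
      have h := entropy_option_le_binEntMono ((Protocol.ofTree D).law_nonneg μ)
        ((Protocol.ofTree D).sum_law μ) (fun ω => some ω.1) (x := 1)
        (prob_le_one ((Protocol.ofTree D).law_nonneg μ) ((Protocol.ofTree D).sum_law μ) _)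
      refine h.trans ?_
      exact mul_le_of_le_one_right (Nat.cast_nonneg _) (binEnt_le_one _)

theorem infoComplexity_le {π : Protocol X Y Z} {μ ν : stdSimplex ℝ (X × Y)} {ε : ℝ}
    (h : π.Performs f ν ε) : infoComplexity μ f ν ε ≤ π.infoCost μ := by
  refine csInf_le ⟨0, ?_⟩ ⟨π, h, rfl⟩
  rintro _ ⟨π', -, rfl⟩
  exact π'.infoCost_nonneg μ

theorem le_infoComplexity {μ : stdSimplex ℝ (X × Y)} {ε c : ℝ} (hε : 0 ≤ ε)
    (h : ∀ π : Protocol X Y Z, π.Performs f μ ε → c ≤ π.infoCost μ) :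
    c ≤ infoComplexity μ f μ ε := by
  obtain ⟨π, hπ, -⟩ := exists_performs_zero f μ
  refine le_csInf ⟨_, π, hπ.mono hε, rfl⟩ ?_
  rintro _ ⟨π', h', rfl⟩
  exact h π' h'

theorem infoComplexity_nonneg (f : X × Y → Z) (μ : stdSimplex ℝ (X × Y)) {ε : ℝ} (hε : 0 ≤ ε) :
    0 ≤ infoComplexity μ f μ ε :=
  le_infoComplexity hε fun π _ => π.infoCost_nonneg μ

theorem infoComplexity_anti (f : X × Y → Z) (μ : stdSimplex ℝ (X × Y)) {ε ε' : ℝ} (hε : 0 ≤ ε)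
    (h : ε ≤ ε') : infoComplexity μ f μ ε' ≤ infoComplexity μ f μ ε :=
  le_infoComplexity hε fun _ hπ => infoComplexity_le (hπ.mono h)

theorem infoComplexity_le_maxDistInfoComplexity (f : X × Y → Z) (μ : stdSimplex ℝ (X × Y)) {ε : ℝ}
    (hε : 0 ≤ ε) : infoComplexity μ f μ ε ≤ maxDistInfoComplexity f ε := by
  refine le_ciSup (f := fun μ : stdSimplex ℝ (X × Y) => infoComplexity μ f μ ε)
    ⟨2 * Fintype.card (X × Y), ?_⟩ μ
  rintro _ ⟨μ, rfl⟩
  obtain ⟨π, hπ, h⟩ := exists_performs_zero f μ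
  exact (infoComplexity_le (hπ.mono hε)).trans h

end Complexity

/-! ### Rectangle weights and inputs under doubt -/

/-- AM-GM with a free weight `t`, later `√ε`, which balances the two terms. -/
theorem le_add_of_sq_le_mul {A B m t : ℝ} (hA : 0 ≤ A) (hB : 0 ≤ B) (ht : 0 < t)
    (h : m ^ 2 ≤ A * B) : m ≤ t / 2 * A + 1 / (2 * t) * B := by
  have h1 : 0 ≤ t / 2 * A + 1 / (2 * t) * B := by positivity
  refine (le_abs_self m).trans (abs_le_of_sq_le_sq ?_ h1)
  have h2 : (t / 2 * A + 1 / (2 * t) * B) ^ 2 - A * B = (t / 2 * A - 1 / (2 * t) * B) ^ 2 := by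
    field_simp
    ring
  nlinarith [sq_nonneg (t / 2 * A - 1 / (2 * t) * B)]

namespace ProtocolTree

open scoped Classical

variable {X Y Z SA SB : Type*}

/-- The factor of Alice in the probability that the bits `l` are transmitted. -/
noncomputable def aliceWeight [Fintype SA] (wA : SA → ℝ) (t : ProtocolTree (X × SA) (Y × SB) Z)
    (l : List Bool) (x : X) : ℝ :=
  ∑ s, wA s * if ∃ b, t.bits (x, s) b = l then 1 else 0

/-- The factor of Bob in the probability that the bits `l` are transmitted. -/
noncomputable def bobWeight [Fintype SB] (wB : SB → ℝ) (t : ProtocolTree (X × SA) (Y × SB) Z)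
    (l : List Bool) (y : Y) : ℝ :=
  ∑ s, wB s * if ∃ a, t.bits a (y, s) = l then 1 else 0

section

variable {wA : SA → ℝ} {wB : SB → ℝ} (t : ProtocolTree (X × SA) (Y × SB) Z)

theorem aliceWeight_nonneg [Fintype SA] (hA : ∀ s, 0 ≤ wA s) (l : List Bool) (x : X) :
    0 ≤ t.aliceWeight wA l x :=
  Finset.sum_nonneg fun s _ => mul_nonneg (hA s) (by split_ifs <;> norm_num)

theorem bobWeight_nonneg [Fintype SB] (hB : ∀ s, 0 ≤ wB s) (l : List Bool) (y : Y) :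
    0 ≤ t.bobWeight wB l y :=
  Finset.sum_nonneg fun s _ => mul_nonneg (hB s) (by split_ifs <;> norm_num)

/-- The product law of transcripts: if one private string is compatible with `l` on Alice's side and
another on Bob's, the rectangle property forces the joint run to produce `l`. -/
theorem sum_comp_bits [Fintype SA] [Fintype SB] (φ : List Bool → ℝ) {L : Finset (List Bool)}
    (hL : ∀ a b, t.bits a b ∈ L) (x : X) (y : Y) :
    ∑ s, wA s * ∑ s', wB s' * φ (t.bits (x, s) (y, s')) =
      ∑ l ∈ L, φ l * (t.aliceWeight wA l x * t.bobWeight wB l y) := by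
  simp only [aliceWeight, bobWeight, Finset.sum_mul_sum]
  simp only [Finset.mul_sum]
  rw [Finset.sum_comm (s := L)]
  refine Finset.sum_congr rfl fun s _ => ?_
  rw [Finset.sum_comm (s := L)]
  refine Finset.sum_congr rfl fun s' _ => ?_
  rw [Finset.sum_eq_single (t.bits (x, s) (y, s'))]
  · rw [if_pos ⟨_, rfl⟩, if_pos ⟨_, rfl⟩]
    ring
  · intro l _ hl
    by_cases h1 : ∃ b, t.bits (x, s) b = l
    · by_cases h2 : ∃ a, t.bits a (y, s') = l
      · obtain ⟨b, hb⟩ := h1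
        obtain ⟨a, ha⟩ := h2
        exact absurd (t.bits_eq_of_bits_eq hb ha).symm hl
      · simp [h2]
    · simp [h1]
  · exact fun h => absurd (hL _ _) h

end

variable [Fintype X] [Fintype Y] [Fintype SA] [Fintype SB]

/-- Alice's inputs to be checked after the bits `l`: those that occur in an input pair satisfying
`M` on which the output is wrong, and that are the less likely member of that pair. -/
def aliceDoubt (wA : SA → ℝ) (wB : SB → ℝ) (t : ProtocolTree (X × SA) (Y × SB) Z)
    (f : X × Y → Z) (M : X × Y → Prop) (l : List Bool) : Set X :=
  {x | ∃ y, M (x, y) ∧ t.label l ≠ f (x, y) ∧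
    t.aliceWeight wA l x * ∑ y', t.bobWeight wB l y' ≤
      t.bobWeight wB l y * ∑ x', t.aliceWeight wA l x'}

/-- Bob's inputs to be checked after the bits `l`, see `aliceDoubt`. -/
def bobDoubt (wA : SA → ℝ) (wB : SB → ℝ) (t : ProtocolTree (X × SA) (Y × SB) Z)
    (f : X × Y → Z) (M : X × Y → Prop) (l : List Bool) : Set Y :=
  {y | ∃ x, M (x, y) ∧ t.label l ≠ f (x, y) ∧
    t.bobWeight wB l y * ∑ x', t.aliceWeight wA l x' ≤
      t.aliceWeight wA l x * ∑ y', t.bobWeight wB l y'}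

variable {wA : SA → ℝ} {wB : SB → ℝ} (t : ProtocolTree (X × SA) (Y × SB) Z)
  {f : X × Y → Z} {M : X × Y → Prop}

/-- Of two normalized weights one is the smaller, so each wrong pair is caught by at least one
player. -/
theorem mem_doubt {l : List Bool} {x : X} {y : Y} (hM : M (x, y)) (h : t.label l ≠ f (x, y)) :
    x ∈ aliceDoubt wA wB t f M l ∨ y ∈ bobDoubt wA wB t f M l := by
  rcases le_total (t.aliceWeight wA l x * ∑ y', t.bobWeight wB l y')
    (t.bobWeight wB l y * ∑ x', t.aliceWeight wA l x') with h1 | h1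
  · exact Or.inl ⟨y, hM, h, h1⟩
  · exact Or.inr ⟨x, hM, h, h1⟩

/-- If `x` is under doubt because of `b`, then `(q x * R)² ≤ (Q * R) * (q x * r b)`. AM-GM bounds `q
x * R`, hence `q x * r y`, and `q x * r b` is one of the terms of the error sum. The case of Bob is
symmetric. -/
theorem weight_le_of_doubt (hA : ∀ s, 0 ≤ wA s) (hB : ∀ s, 0 ≤ wB s) {c : ℝ} (hc : 0 < c)
    {l : List Bool} {x : X} {y : Y}
    (h : x ∈ aliceDoubt wA wB t f M l ∨ y ∈ bobDoubt wA wB t f M l) :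
    t.aliceWeight wA l x * t.bobWeight wB l y ≤
      c / 2 * ((∑ x', t.aliceWeight wA l x') * ∑ y', t.bobWeight wB l y') +
      1 / (2 * c) * ∑ e : X × Y, (if M e ∧ t.label l ≠ f e then 1 else 0) *
        (t.aliceWeight wA l e.1 * t.bobWeight wB l e.2) := by
  set q := t.aliceWeight wA l
  set r := t.bobWeight wB l
  have hq : ∀ x, 0 ≤ q x := t.aliceWeight_nonneg hA l
  have hr : ∀ x, 0 ≤ r x := t.bobWeight_nonneg hB l
  have hQ : ∀ x, q x ≤ ∑ x', q x' := fun x =>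
    Finset.single_le_sum (fun x _ => hq x) (Finset.mem_univ x)
  have hR : ∀ x, r x ≤ ∑ x', r x' := fun x =>
    Finset.single_le_sum (fun x _ => hr x) (Finset.mem_univ x)
  have hbad : ∀ a b, M (a, b) → t.label l ≠ f (a, b) → q a * r b ≤
      ∑ e : X × Y, (if M e ∧ t.label l ≠ f e then 1 else 0) * (q e.1 * r e.2) := by
    intro a b h1 h2
    have := Finset.single_le_sum (f := fun e : X × Y =>
      (if M e ∧ t.label l ≠ f e then (1 : ℝ) else 0) * (q e.1 * r e.2))
      (fun e _ => mul_nonneg (by split_ifs <;> norm_num) (mul_nonneg (hq _) (hr _)))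
      (Finset.mem_univ (a, b))
    simpa only [h1, h2, ne_eq, not_false_eq_true, and_self, if_true, one_mul] using this
  set Q := ∑ x', q x'
  set R := ∑ y', r y'
  set bad := ∑ e : X × Y, (if M e ∧ t.label l ≠ f e then (1 : ℝ) else 0) * (q e.1 * r e.2)
  have hQ0 : 0 ≤ Q := (hq x).trans (hQ x)
  have hR0 : 0 ≤ R := (hr y).trans (hR y)
  have hc' : 0 ≤ 1 / (2 * c) := by positivity
  rcases h with ⟨b, hM, hne, hle⟩ | ⟨a, hM, hne, hle⟩
  · have h1 : q x * R ≤ c / 2 * (Q * R) + 1 / (2 * c) * (q x * r b) := by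
      refine le_add_of_sq_le_mul (mul_nonneg hQ0 hR0) (mul_nonneg (hq _) (hr _)) hc ?_
      have := mul_le_mul_of_nonneg_left hle (mul_nonneg (hq x) hR0)
      linarith
    have h2 := mul_le_mul_of_nonneg_left (hR y) (hq x)
    have h3 := mul_le_mul_of_nonneg_left (hbad x b hM hne) hc'
    linarith
  · have h1 : Q * r y ≤ c / 2 * (Q * R) + 1 / (2 * c) * (q a * r y) := by
      refine le_add_of_sq_le_mul (mul_nonneg hQ0 hR0) (mul_nonneg (hq _) (hr _)) hc ?_
      have := mul_le_mul_of_nonneg_left hle (mul_nonneg (hr y) hQ0)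
      linarith
    have h2 := mul_le_mul_of_nonneg_right (hQ x) (hr y)
    have h3 := mul_le_mul_of_nonneg_left (hbad a y hM hne) hc'
    linarith

/-- `weight_le_of_doubt` summed over transcripts. The products `Q * R` add up to `|X × Y|`, since
the transcript weights of each input pair have sum `1`. -/
theorem sum_doubt_le (hA : ∀ s, 0 ≤ wA s) (hB : ∀ s, 0 ≤ wB s) (hA1 : ∑ s, wA s = 1)
    (hB1 : ∑ s, wB s = 1) {c : ℝ} (hc : 0 < c) (x : X) (y : Y) :
    ∑ s, wA s * ∑ s', wB s' *
      (if x ∈ aliceDoubt wA wB t f M (t.bits (x, s) (y, s')) ∨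
        y ∈ bobDoubt wA wB t f M (t.bits (x, s) (y, s')) then (1 : ℝ) else 0) ≤
      c / 2 * Fintype.card (X × Y) + 1 / (2 * c) * ∑ e : X × Y, ∑ s, wA s * ∑ s', wB s' *
        (if M e ∧ t.output (e.1, s) (e.2, s') ≠ f e then (1 : ℝ) else 0) := by
  set L := Finset.univ.image fun w : (X × SA) × (Y × SB) => t.bits w.1 w.2
  have hL : ∀ a b, t.bits a b ∈ L := fun a b =>
    Finset.mem_image_of_mem (fun w : (X × SA) × (Y × SB) => t.bits w.1 w.2)
      (Finset.mem_univ (a, b))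
  have hone : ∀ x y, ∑ l ∈ L, t.aliceWeight wA l x * t.bobWeight wB l y = 1 := by
    intro x y
    have := t.sum_comp_bits (wA := wA) (wB := wB) (fun _ => 1) hL x y
    simpa [hA1, hB1] using this.symm
  have htot : ∑ l ∈ L, (∑ x', t.aliceWeight wA l x') * ∑ y', t.bobWeight wB l y' =
      Fintype.card (X × Y) := by
    simp_rw [Finset.sum_mul_sum]
    rw [Finset.sum_comm]
    simp_rw [Finset.sum_comm (s := L), hone]
    simp [Fintype.card_prod]
  rw [t.sum_comp_bits (fun l => if x ∈ aliceDoubt wA wB t f M l ∨ y ∈ bobDoubt wA wB t f M l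
    then (1 : ℝ) else 0) hL x y]
  have herr : ∀ e : X × Y, ∑ s, wA s * ∑ s', wB s' *
      (if M e ∧ t.output (e.1, s) (e.2, s') ≠ f e then (1 : ℝ) else 0) =
      ∑ l ∈ L, (if M e ∧ t.label l ≠ f e then 1 else 0) *
        (t.aliceWeight wA l e.1 * t.bobWeight wB l e.2) := by
    intro e
    rw [← t.sum_comp_bits (fun l => if M e ∧ t.label l ≠ f e then (1 : ℝ) else 0) hL]
    simp_rw [t.label_bits]
  simp_rw [herr]
  rw [← htot, Finset.sum_comm (t := L), Finset.mul_sum, Finset.mul_sum, ← Finset.sum_add_distrib]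
  refine Finset.sum_le_sum fun l _ => ?_
  have hq := t.aliceWeight_nonneg hA l
  have hr := t.bobWeight_nonneg hB l
  split_ifs with h
  · rw [one_mul]
    exact t.weight_le_of_doubt hA hB hc h
  · rw [zero_mul]
    refine add_nonneg (mul_nonneg (by positivity) (mul_nonneg (Finset.sum_nonneg fun x _ => hq x)
      (Finset.sum_nonneg fun x _ => hr x))) (mul_nonneg (by positivity) (Finset.sum_nonneg
        fun e _ => mul_nonneg (by split_ifs <;> norm_num) (mul_nonneg (hq _) (hr _))))

end ProtocolTree

/-! ### Removing the error by rechecking doubtful inputs -/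

namespace Protocol

open scoped Classical

variable {X Y Z : Type*}

/-- Run `π`; then check whether Alice's input is in `S` or Bob's input is in `T`, sets that depend
on the transcript, and if so run `D`. -/
noncomputable def recheck (π : Protocol X Y Z) (S : π.PublicString → List Bool → Set X)
    (T : π.PublicString → List Bool → Set Y) (D : ProtocolTree X Y Z) : Protocol X Y Z where
  PublicString := π.PublicString
  AliceString := π.AliceString
  BobString := π.BobString
  publicLaw := π.publicLaw
  aliceLaw := π.aliceLaw
  bobLaw := π.bobLaw
  tree r := (π.tree r).graft fun l =>
    (ProtocolTree.check (S r l) (T r l) ((π.tree r).label l) D).comap Prod.fst Prod.fst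

variable (π : Protocol X Y Z) (S : π.PublicString → List Bool → Set X)
  (T : π.PublicString → List Bool → Set Y) (D : ProtocolTree X Y Z)

/-- The event that the check in `recheck` is positive. -/
def Doubt (ω : π.Sample) : Prop :=
  ω.1.1 ∈ S ω.2.1 (π.transcript ω).2 ∨ ω.1.2 ∈ T ω.2.1 (π.transcript ω).2

theorem transcript_recheck (ω : π.Sample) :
    (π.recheck S T D).transcript ω = ((π.transcript ω).1, (π.transcript ω).2 ++
      (ProtocolTree.check (S ω.2.1 (π.transcript ω).2) (T ω.2.1 (π.transcript ω).2)
        ((π.tree ω.2.1).label (π.transcript ω).2) D).bits ω.1.1 ω.1.2) := by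
  refine Prod.ext rfl ?_
  refine (ProtocolTree.bits_graft _ _ _ _).trans ?_
  exact congrArg ((π.transcript ω).2 ++ ·) (ProtocolTree.bits_comap _ _ _ _ _)

theorem output_recheck (ω : π.Sample) :
    (π.recheck S T D).output ω =
      if π.Doubt S T ω then D.output ω.1.1 ω.1.2 else π.output ω := by
  refine (ProtocolTree.output_graft _ _ _ _).trans ((ProtocolTree.output_comap _ _ _ _ _).trans ?_)
  split_ifs with h
  · exact ProtocolTree.output_check_of_mem _ _ h
  · exact (ProtocolTree.output_check_of_notMem _ _ h).trans (ProtocolTree.label_bits _ _ _)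

variable [Fintype X] [Fintype Y]

/-- Without doubt the added bits are always two times `false`, and with doubt the input pair
determines them. The variable `E` records exactly this, and its entropy is paid once for each of the
two mutual informations. -/
theorem infoCost_recheck_le (μ : stdSimplex ℝ (X × Y)) {x : ℝ}
    (hx : prob (π.law μ) (π.Doubt S T) ≤ x) :
    (π.recheck S T D).infoCost μ ≤
      π.infoCost μ + 2 * (Fintype.card (X × Y) * binEntMono x) := by
  set E : π.Sample → Option (X × Y) := fun ω => if π.Doubt S T ω then some ω.1 else none with hE
  have hent : entropy (π.law μ) E ≤ Fintype.card (X × Y) * binEntMono x := by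
    refine entropy_option_le_binEntMono (π.law_nonneg μ) (π.sum_law μ) E (le_trans ?_ hx)
    refine prob_mono (π.law_nonneg μ) fun ω _ h => ?_
    by_contra h'
    exact h (if_neg h')
  have h : ∀ ω ω' : π.Sample, π.transcript ω = π.transcript ω' → E ω = E ω' →
      (π.recheck S T D).transcript ω = (π.recheck S T D).transcript ω' := by
    intro ω ω' h1 h2
    have h3 : ω.2.1 = ω'.2.1 := (Prod.ext_iff.1 h1).1
    rw [transcript_recheck, transcript_recheck, ← h1, ← h3]
    congr 2
    simp only [hE] at h2
    split_ifs at h2 with h4 h5 h5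
    · rw [Option.some.inj h2]
    · have h4' : ¬ (ω.1.1 ∈ S ω.2.1 (π.transcript ω).2 ∨ ω.1.2 ∈ T ω.2.1 (π.transcript ω).2) := h4
      have h5' : ¬ (ω'.1.1 ∈ S ω'.2.1 (π.transcript ω').2 ∨
        ω'.1.2 ∈ T ω'.2.1 (π.transcript ω').2) := h5
      rw [← h1, ← h3] at h5'
      rw [ProtocolTree.bits_check_of_notMem _ _ h4', ProtocolTree.bits_check_of_notMem _ _ h5']
  have h' : ∀ ω ω' : π.Sample,
      (π.recheck S T D).transcript ω = (π.recheck S T D).transcript ω' →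
        π.transcript ω = π.transcript ω' := by
    intro ω ω' h1
    rw [transcript_recheck, transcript_recheck] at h1
    have h2 : ω.2.1 = ω'.2.1 := (Prod.ext_iff.1 h1).1
    have h3 := (Prod.ext_iff.1 h1).2
    refine Prod.ext h2 ?_
    simp only [transcript] at h3 ⊢
    rw [h2] at h3 ⊢
    exact ProtocolTree.bits_eq_of_append_eq _ h3
  have h1 := condMutualInfo_le_add_entropy (π.law_nonneg μ) (π.sum_law μ) h h' π.inputX π.inputY
  have h2 := condMutualInfo_le_add_entropy (π.law_nonneg μ) (π.sum_law μ) h h' π.inputY π.inputX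
  have h3 : (π.recheck S T D).infoCost μ =
      condMutualInfo (π.law μ) (π.recheck S T D).transcript π.inputX π.inputY +
      condMutualInfo (π.law μ) (π.recheck S T D).transcript π.inputY π.inputX := rfl
  rw [h3, infoCost]
  linarith

/-- The probability that the check is positive, for the sets `aliceDoubt` and `bobDoubt`. -/
theorem prob_doubt_le {f : X × Y → Z} {μ : stdSimplex ℝ (X × Y)} {ε : ℝ} (hε : 0 < ε)
    (h : π.Performs f μ ε) :
    prob (π.law μ) (π.Doubt
      (fun r => ProtocolTree.aliceDoubt π.aliceLaw π.bobLaw (π.tree r) f fun e => μ e ≠ 0)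
      (fun r => ProtocolTree.bobDoubt π.aliceLaw π.bobLaw (π.tree r) f fun e => μ e ≠ 0)) ≤
      (Fintype.card (X × Y) + ∑ e, (μ e)⁻¹ + 1) * Real.sqrt ε := by
  set c := Real.sqrt ε
  have hc : 0 < c := Real.sqrt_pos.2 hε
  have hcc : c * c = ε := Real.mul_self_sqrt hε.le
  set err : π.PublicString → X × Y → ℝ := fun r e => ∑ s, π.aliceLaw s * ∑ s', π.bobLaw s' *
    (if (π.tree r).output (e.1, s) (e.2, s') ≠ f e then (1 : ℝ) else 0) with herr
  have herr0 : ∀ r e, 0 ≤ err r e := fun r e =>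
    Finset.sum_nonneg fun s _ => mul_nonneg (π.aliceLaw.2.1 s) (Finset.sum_nonneg fun s' _ =>
      mul_nonneg (π.bobLaw.2.1 s') (by split_ifs <;> norm_num))
  set B : π.PublicString → ℝ := fun r => c / 2 * Fintype.card (X × Y) + 1 / (2 * c) *
    ∑ e : X × Y, (if μ e ≠ 0 then 1 else 0) * err r e with hB
  have h1 : prob (π.law μ) (π.Doubt
      (fun r => ProtocolTree.aliceDoubt π.aliceLaw π.bobLaw (π.tree r) f fun e => μ e ≠ 0)
      (fun r => ProtocolTree.bobDoubt π.aliceLaw π.bobLaw (π.tree r) f fun e => μ e ≠ 0)) ≤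
      ∑ e, μ e * ∑ r, π.publicLaw r * B r := by
    rw [prob_eq_sum_ite, sum_law_mul]
    refine Finset.sum_le_sum fun e _ => mul_le_mul_of_nonneg_left ?_ (μ.2.1 e)
    refine Finset.sum_le_sum fun r _ => mul_le_mul_of_nonneg_left ?_ (π.publicLaw.2.1 r)
    have hle := (π.tree r).sum_doubt_le (wA := π.aliceLaw) (wB := π.bobLaw) (f := f)
      (M := fun e => μ e ≠ 0) π.aliceLaw.2.1 π.bobLaw.2.1 π.aliceLaw.2.2 π.bobLaw.2.2 hc e.1 e.2
    refine le_trans (le_of_eq ?_) (hle.trans (le_of_eq ?_))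
    · exact Finset.sum_congr rfl fun s _ => congrArg _ (Finset.sum_congr rfl fun s' _ =>
        congrArg _ (if_congr Iff.rfl rfl rfl))
    simp only [hB, herr]
    congr 2
    refine Finset.sum_congr rfl fun e' _ => ?_
    by_cases h0 : μ e' = 0 <;> simp [h0]
  have hperf : ∑ e, μ e * ∑ r, π.publicLaw r * err r e ≤ ε := by
    unfold Performs at h
    rw [prob_eq_sum_ite, sum_law_mul] at h
    refine le_trans (le_of_eq ?_) h
    exact Finset.sum_congr rfl fun e _ => congrArg _ (Finset.sum_congr rfl fun r _ =>
      congrArg _ (Finset.sum_congr rfl fun s _ => congrArg _ (Finset.sum_congr rfl fun s' _ =>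
        congrArg _ (by congr))))
  have herr1 : ∀ e, 0 ≤ ∑ r, π.publicLaw r * err r e := fun e =>
    Finset.sum_nonneg fun r _ => mul_nonneg (π.publicLaw.2.1 r) (herr0 r e)
  -- On an input `e` of the support the error is at most `ε / μ e`. Off the support the indicator is
  -- `0`, and so is `(μ e)⁻¹`.
  have h2 : ∑ r, π.publicLaw r * ∑ e : X × Y, (if μ e ≠ 0 then 1 else 0) * err r e ≤
      (∑ e, (μ e)⁻¹) * ε := by
    have : ∑ r, π.publicLaw r * ∑ e : X × Y, (if μ e ≠ 0 then 1 else 0) * err r e =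
        ∑ e, (μ e)⁻¹ * (μ e * ∑ r, π.publicLaw r * err r e) := by
      simp only [Finset.mul_sum]
      rw [Finset.sum_comm]
      refine Finset.sum_congr rfl fun e _ => Finset.sum_congr rfl fun r _ => ?_
      by_cases h0 : μ e = 0
      · simp [h0]
      · rw [inv_mul_cancel_left₀ h0, if_pos h0, one_mul]
    rw [this, Finset.sum_mul]
    refine Finset.sum_le_sum fun e _ => mul_le_mul_of_nonneg_left ?_ (inv_nonneg.2 (μ.2.1 e))
    exact (Finset.single_le_sum (f := fun e => μ e * ∑ r, π.publicLaw r * err r e)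
      (fun e _ => mul_nonneg (μ.2.1 e) (herr1 e)) (Finset.mem_univ e)).trans hperf
  have h3 : ∑ r, π.publicLaw r * B r = c / 2 * Fintype.card (X × Y) + 1 / (2 * c) *
      ∑ r, π.publicLaw r * ∑ e : X × Y, (if μ e ≠ 0 then 1 else 0) * err r e := by
    simp only [hB, mul_add, Finset.sum_add_distrib, ← Finset.sum_mul]
    have : ∑ r, π.publicLaw r = 1 := π.publicLaw.2.2
    rw [this, one_mul, Finset.mul_sum]
    congr 1
    exact Finset.sum_congr rfl fun r _ => by ring
  have h4 : ∑ e, μ e = 1 := μ.2.2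
  rw [← Finset.sum_mul, h4, one_mul, h3] at h1
  refine h1.trans ?_
  -- Here `c = √ε` turns `ε / c` into `√ε`.
  have h5 : 1 / (2 * c) * ((∑ e, (μ e)⁻¹) * ε) = c / 2 * ∑ e, (μ e)⁻¹ := by
    rw [← hcc]
    field_simp
  have h6 := mul_le_mul_of_nonneg_left h2 (show 0 ≤ 1 / (2 * c) by positivity)
  have h7 : (0 : ℝ) ≤ c * Fintype.card (X × Y) := by positivity
  have h8 : 0 ≤ c * ∑ e, (μ e)⁻¹ :=
    mul_nonneg hc.le (Finset.sum_nonneg fun e _ => inv_nonneg.2 (μ.2.1 e))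
  linarith

end Protocol

/-- Removing an error `ε` costs at most `O(h(√ε))`, for a fixed input distribution. -/
theorem infoComplexity_zero_le {X Y Z : Type*} [Fintype X] [Fintype Y] (f : X × Y → Z)
    (μ : stdSimplex ℝ (X × Y)) : ∃ C : ℝ, 0 < C ∧ ∀ ε : ℝ, 0 ≤ ε →
      infoComplexity μ f μ 0 ≤ infoComplexity μ f μ ε + C * binEntMono (Real.sqrt ε) := by
  obtain ⟨x₀, y₀⟩ := nonempty_of_stdSimplex μ
  have : Nonempty X := ⟨x₀⟩
  have : Nonempty Y := ⟨y₀⟩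
  obtain ⟨D, hD⟩ := ProtocolTree.exists_forall_output_eq f
  -- The summand `1` ensures `1 ≤ K`, as `binEntMono_mul_le` requires.
  set K : ℝ := Fintype.card (X × Y) + ∑ e, (μ e)⁻¹ + 1 with hK_def
  have hK : 1 ≤ K := by
    have : 0 ≤ ∑ e, (μ e)⁻¹ := Finset.sum_nonneg fun e _ => inv_nonneg.2 (μ.2.1 e)
    have : (0 : ℝ) ≤ Fintype.card (X × Y) := Nat.cast_nonneg _
    linarith
  have hN : (0 : ℝ) < Fintype.card (X × Y) := Nat.cast_pos.2 Fintype.card_pos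
  refine ⟨2 * (Fintype.card (X × Y) * K), by positivity, fun ε hε => ?_⟩
  rcases hε.eq_or_lt with rfl | hε0
  · simp [binEntMono_zero]
  rw [← sub_le_iff_le_add]
  refine le_infoComplexity hε fun π hπ => ?_
  have hcost := π.infoCost_recheck_le _ _ D μ (π.prob_doubt_le hε0 hπ)
  have hmul := binEntMono_mul_le hK (Real.sqrt_nonneg ε)
  have hperf : (π.recheck
      (fun r => ProtocolTree.aliceDoubt π.aliceLaw π.bobLaw (π.tree r) f fun e => μ e ≠ 0)
      (fun r => ProtocolTree.bobDoubt π.aliceLaw π.bobLaw (π.tree r) f fun e => μ e ≠ 0)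
      D).Performs f μ 0 := by
    refine Protocol.performs_of_forall le_rfl fun ω h0 => ?_
    refine (π.output_recheck _ _ D ω).trans ?_
    split_ifs with h
    · exact hD _ _
    · by_contra hne
      refine h (ProtocolTree.mem_doubt (π.tree ω.2.1) (left_ne_zero_of_mul h0) fun heq => hne ?_)
      exact (ProtocolTree.label_bits _ _ _).symm.trans heq
  have h1 := infoComplexity_le (μ := μ) hperf
  have h2 := mul_le_mul_of_nonneg_left hmul hN.le
  rw [sub_le_iff_le_add]
  calc _ ≤ _ := h1
    _ ≤ _ := hcost
    _ ≤ _ := by linarith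

/-! ### Conditional entropy for independent sources -/

section Independence

variable {Ω Ω' Ω₁ Ω₂ α β γ : Type*} [Fintype Ω] [Fintype Ω'] [Fintype Ω₁] [Fintype Ω₂] {p : Ω → ℝ}

theorem condMutualInfo_comp {p' : Ω' → ℝ} {g : Ω' → Ω}
    (hg : ∀ φ : Ω → ℝ, ∑ ω, p' ω * φ (g ω) = ∑ ω, p ω * φ ω)
    (A : Ω → α) (B : Ω → β) (C : Ω → γ) :
    condMutualInfo p' (fun ω => A (g ω)) (fun ω => B (g ω)) (fun ω => C (g ω)) =
      condMutualInfo p A B C := by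
  simp only [condMutualInfo, condEntropy]
  rw [entropy_comp hg C, entropy_comp hg fun ω => (A ω, C ω), entropy_comp hg fun ω => (B ω, C ω),
    entropy_comp hg fun ω => (A ω, B ω, C ω)]

/-- Used to verify conditional independence: conditional entropies of the same variable agree once
both are evaluated to the same average. -/
theorem condEntropy_of_indep {p₁ : Ω₁ → ℝ} {p₂ : Ω₂ → ℝ} (h₁ : ∀ ω, 0 ≤ p₁ ω)
    (h₂ : ∀ ω, 0 ≤ p₂ ω) (h₂' : ∑ ω, p₂ ω = 1) {k₁ : Ω → Ω₁} {k₂ : Ω → Ω₂}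
    (hk : ∀ φ : Ω₁ × Ω₂ → ℝ, ∑ ω, p ω * φ (k₁ ω, k₂ ω) = ∑ x, p₁ x.1 * p₂ x.2 * φ x)
    (V : Ω₁ → α) (F : α → Ω₂ → β) :
    condEntropy p (fun ω => F (V (k₁ ω)) (k₂ ω)) (fun ω => V (k₁ ω)) =
      ∑ ω, p₁ ω * entropy p₂ (F (V ω)) := by
  have h := entropy_prod_indep h₁ h₂ h₂' V F
  rw [← entropy_comp (g := fun ω => (k₁ ω, k₂ ω)) hk] at h
  have hk₁ : ∀ φ : Ω₁ → ℝ, ∑ ω, p ω * φ (k₁ ω) = ∑ x, p₁ x * φ x := by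
    intro φ
    rw [hk fun x => φ x.1, Fintype.sum_prod_type]
    refine Finset.sum_congr rfl fun x _ => ?_
    change ∑ y, p₁ x * p₂ y * φ x = _
    rw [← Finset.sum_mul, ← Finset.mul_sum, h₂', mul_one]
  rw [condEntropy, h, entropy_comp hk₁ V]
  ring

end Independence

/-- The law of a biased coin. -/
noncomputable def coin (ε : ℝ) (u : Bool) : ℝ := if u then ε else 1 - ε

theorem coin_nonneg {ε : ℝ} (hε : ε ∈ Set.Icc (0 : ℝ) 1) (u : Bool) : 0 ≤ coin ε u := by
  cases u <;> simp [coin, hε.1, hε.2]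

theorem sum_coin (ε : ℝ) : ∑ u, coin ε u = 1 := by simp [coin]

theorem entropy_coin (ε : ℝ) : entropy (coin ε) id = binEnt ε := by
  rw [entropy_eq_sum_of_subset (coin ε) (S := Finset.univ) id (by simp), binEnt_eq]
  simp [prob_eq_sum_ite, coin]

/-- Apply `σ` if the coin shows `true`. -/
def flipBy {X : Type*} (σ : Equiv.Perm X) (u : Bool) : Equiv.Perm X := if u then σ else 1

namespace ProtocolTree

variable {A B Z : Type*}

/-- Exchange of the roles of the players. -/
def swap : ProtocolTree A B Z → ProtocolTree B A Z
  | leaf z => leaf z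
  | alice msg next => bob msg fun c => (next c).swap
  | bob msg next => alice msg fun c => (next c).swap

theorem bits_swap (t : ProtocolTree A B Z) (a : A) (b : B) : t.swap.bits b a = t.bits a b := by
  induction t with
  | leaf => rfl
  | alice msg next ih => simp [swap, bits, ih]
  | bob msg next ih => simp [swap, bits, ih]

theorem output_swap (t : ProtocolTree A B Z) (a : A) (b : B) :
    t.swap.output b a = t.output a b := by
  induction t with
  | leaf => rfl
  | alice msg next ih => simp [swap, output, ih]
  | bob msg next ih => simp [swap, output, ih]

end ProtocolTree

/-! ### Symmetry between the players -/

section Swap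

variable {X Y Z : Type*} [Fintype X] [Fintype Y]

/-- Exchange of the roles of the players in an input distribution. -/
def swapInput (μ : stdSimplex ℝ (X × Y)) : stdSimplex ℝ (Y × X) :=
  ⟨fun q => μ q.swap, fun _ => μ.2.1 _, ((Equiv.prodComm Y X).sum_comp μ).trans μ.2.2⟩

/-- Exchange of the roles of the players in a protocol. -/
def Protocol.swap (π : Protocol X Y Z) : Protocol Y X Z where
  PublicString := π.PublicString
  AliceString := π.BobString
  BobString := π.AliceString
  publicLaw := π.publicLaw
  aliceLaw := π.bobLaw
  bobLaw := π.aliceLaw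
  tree r := (π.tree r).swap

/-- The sample of `π` that corresponds to a sample of `π.swap`. -/
def Protocol.unswap (π : Protocol X Y Z) (ω : π.swap.Sample) : π.Sample :=
  (ω.1.swap, ω.2.1, ω.2.2.2, ω.2.2.1)

theorem Protocol.sum_unswap (π : Protocol X Y Z) (μ : stdSimplex ℝ (X × Y)) (φ : π.Sample → ℝ) :
    ∑ ω, π.swap.law (swapInput μ) ω * φ (π.unswap ω) = ∑ ω, π.law μ ω * φ ω := by
  rw [sum_law_mul, sum_law_mul, ← (Equiv.prodComm Y X).sum_comp]
  refine Finset.sum_congr rfl fun q _ => congrArg _ (Finset.sum_congr rfl fun r _ =>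
    congrArg _ ?_)
  change ∑ b, π.bobLaw b * ∑ a, π.aliceLaw a * φ (q.swap, r, a, b) =
    ∑ a, π.aliceLaw a * ∑ b, π.bobLaw b * φ (q.swap, r, a, b)
  simp only [Finset.mul_sum]
  rw [Finset.sum_comm]
  exact Finset.sum_congr rfl fun a _ => Finset.sum_congr rfl fun b _ => by ring

theorem Protocol.infoCost_swap (π : Protocol X Y Z) (μ : stdSimplex ℝ (X × Y)) :
    π.swap.infoCost (swapInput μ) = π.infoCost μ := by
  have hT : π.swap.transcript = fun ω => π.transcript (π.unswap ω) :=
    funext fun ω => Prod.ext rfl (ProtocolTree.bits_swap _ _ _)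
  have h1 := condMutualInfo_comp (π.sum_unswap μ) π.transcript π.inputX π.inputY
  have h2 := condMutualInfo_comp (π.sum_unswap μ) π.transcript π.inputY π.inputX
  rw [infoCost, infoCost, ← h1, ← h2, hT, add_comm]
  rfl

theorem Protocol.Performs.swap {π : Protocol X Y Z} {f : X × Y → Z} {ν : stdSimplex ℝ (X × Y)}
    {ε : ℝ} (h : π.Performs f ν ε) :
    π.swap.Performs (fun q => f q.swap) (swapInput ν) ε := by
  classical
  refine le_trans (le_of_eq ?_) h
  have hO : π.swap.output = fun ω => π.output (π.unswap ω) :=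
    funext fun ω => ProtocolTree.output_swap _ _ _
  rw [prob_eq_sum_ite, prob_eq_sum_ite, ← π.sum_unswap ν, hO]
  rfl

theorem infoComplexity_swap_le (f : X × Y → Z) (μ : stdSimplex ℝ (X × Y)) {ε : ℝ} (hε : 0 ≤ ε) :
    infoComplexity (swapInput μ) (fun q => f q.swap) (swapInput μ) ε ≤ infoComplexity μ f μ ε :=
  le_infoComplexity hε fun π hπ => π.infoCost_swap μ ▸ infoComplexity_le hπ.swap

theorem infoComplexity_swap (f : X × Y → Z) (μ : stdSimplex ℝ (X × Y)) {ε : ℝ} (hε : 0 ≤ ε) :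
    infoComplexity (swapInput μ) (fun q => f q.swap) (swapInput μ) ε = infoComplexity μ f μ ε :=
  le_antisymm (infoComplexity_swap_le f μ hε)
    (infoComplexity_swap_le (fun q => f q.swap) (swapInput μ) hε)

theorem maxDistInfoComplexity_swap_le [Nonempty (X × Y)] (f : X × Y → Z) {ε : ℝ} (hε : 0 ≤ ε) :
    maxDistInfoComplexity (fun q : Y × X => f q.swap) ε ≤ maxDistInfoComplexity f ε := by
  have : Nonempty (Y × X) := (Equiv.prodComm X Y).nonempty_congr.1 ‹_›
  refine ciSup_le fun μ => ?_
  exact (infoComplexity_swap (fun q : Y × X => f q.swap) μ hε).symm.le.trans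
    (infoComplexity_le_maxDistInfoComplexity f (swapInput μ) hε)

end Swap

/-! ### Private noise on Alice's input -/

section Noise

variable {X Y Z : Type*}

/-- Alice replaces her input `x` by `σ x` with probability `ε` before `π` is run. -/
noncomputable def Protocol.noisy (π : Protocol X Y Z) (σ : Equiv.Perm X) {ε : ℝ}
    (hε : ε ∈ Set.Icc (0 : ℝ) 1) : Protocol X Y Z where
  PublicString := π.PublicString
  AliceString := π.AliceString × Bool
  BobString := π.BobString
  publicLaw := π.publicLaw
  aliceLaw := ⟨fun s => π.aliceLaw s.1 * coin ε s.2,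
    fun s => mul_nonneg (π.aliceLaw.2.1 _) (coin_nonneg hε _), by
      have h : ∑ s, π.aliceLaw s = 1 := π.aliceLaw.2.2
      rw [Fintype.sum_prod_type]
      simp_rw [← Finset.mul_sum, sum_coin, mul_one, h]⟩
  bobLaw := π.bobLaw
  tree r := (π.tree r).comap (fun a => (flipBy σ a.2.2 a.1, a.2.1)) id

namespace Protocol

variable (π : Protocol X Y Z) (σ : Equiv.Perm X) {ε : ℝ} (hε : ε ∈ Set.Icc (0 : ℝ) 1)

/-- The sample of `π` that is run in a sample of `π.noisy σ hε`. -/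
def denoise (ω : (π.noisy σ hε).Sample) : π.Sample :=
  ((flipBy σ ω.2.2.1.2 ω.1.1, ω.1.2), ω.2.1, ω.2.2.1.1, ω.2.2.2)

theorem transcript_noisy (ω : (π.noisy σ hε).Sample) :
    (π.noisy σ hε).transcript ω = π.transcript (π.denoise σ hε ω) :=
  Prod.ext rfl (ProtocolTree.bits_comap _ _ _ _ _)

theorem output_noisy (ω : (π.noisy σ hε).Sample) :
    (π.noisy σ hε).output ω = π.output (π.denoise σ hε ω) :=
  ProtocolTree.output_comap _ _ _ _ _

end Protocol

variable [Fintype X] [Fintype Y]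

/-- The joint law of the noisy input of Alice and the input of Bob. -/
noncomputable def noisyInput (σ : Equiv.Perm X) {ε : ℝ} (hε : ε ∈ Set.Icc (0 : ℝ) 1)
    (μ : stdSimplex ℝ (X × Y)) : stdSimplex ℝ (X × Y) :=
  ⟨fun q => ∑ u, coin ε u * μ ((flipBy σ u).symm q.1, q.2),
    fun q => Finset.sum_nonneg fun u _ => mul_nonneg (coin_nonneg hε u) (μ.2.1 _), by
      rw [Finset.sum_comm, ← sum_coin ε]
      refine Finset.sum_congr rfl fun u _ => ?_
      rw [← Finset.mul_sum]
      have h1 : ∑ q, μ q = 1 := μ.2.2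
      have h2 := (Equiv.prodCongr (flipBy σ u).symm (Equiv.refl Y)).sum_comp μ
      rw [h1] at h2
      exact (congrArg _ h2).trans (mul_one _)⟩

namespace Protocol

variable (π : Protocol X Y Z) (σ : Equiv.Perm X) {ε : ℝ} (hε : ε ∈ Set.Icc (0 : ℝ) 1)
  (μ : stdSimplex ℝ (X × Y))

theorem sum_noisy (φ : (X × Y) × Bool → π.PublicString × π.AliceString × π.BobString → ℝ) :
    ∑ ω, (π.noisy σ hε).law μ ω * φ (ω.1, ω.2.2.1.2) (ω.2.1, ω.2.2.1.1, ω.2.2.2) =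
      ∑ q, μ q * ∑ u, coin ε u * ∑ r, π.publicLaw r * ∑ a, π.aliceLaw a *
        ∑ b, π.bobLaw b * φ (q, u) (r, a, b) := by
  rw [sum_law_mul]
  refine Finset.sum_congr rfl fun q _ => congrArg _ ?_
  change ∑ r, π.publicLaw r * ∑ a : π.AliceString × Bool, (π.aliceLaw a.1 * coin ε a.2) *
    ∑ b, π.bobLaw b * φ (q, a.2) (r, a.1, b) = _
  simp only [Fintype.sum_prod_type (α₁ := π.AliceString), Finset.mul_sum]
  rw [Finset.sum_comm (t := (Finset.univ : Finset π.PublicString))]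
  refine Finset.sum_congr rfl fun r _ => ?_
  rw [Finset.sum_comm (t := (Finset.univ : Finset π.AliceString))]
  exact Finset.sum_congr rfl fun a _ => Finset.sum_congr rfl fun u _ =>
    Finset.sum_congr rfl fun b _ => by ring

/-- `denoise` is measure preserving, so information quantities of `π` on the noisy input law can be
computed in the sample space of `π.noisy`, where `X` and `X'` live together. -/
theorem sum_denoise (φ : π.Sample → ℝ) :
    ∑ ω, (π.noisy σ hε).law μ ω * φ (π.denoise σ hε ω) =
      ∑ ω, π.law (noisyInput σ hε μ) ω * φ ω := by
  refine (π.sum_noisy σ hε μ fun x z => φ ((flipBy σ x.2 x.1.1, x.1.2), z)).trans ?_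
  rw [sum_law_mul]
  set G : X × Y → ℝ := fun q => ∑ r, π.publicLaw r * ∑ a, π.aliceLaw a *
        ∑ b, π.bobLaw b * φ (q, r, a, b)
  change ∑ q, μ q * ∑ u, coin ε u * G (flipBy σ u q.1, q.2) =
    ∑ q : X × Y, (∑ u, coin ε u * μ ((flipBy σ u).symm q.1, q.2)) * G q
  simp only [Finset.mul_sum, Finset.sum_mul]
  rw [Finset.sum_comm]
  rw [Finset.sum_comm (s := (Finset.univ : Finset (X × Y)))]
  refine Finset.sum_congr rfl fun u _ => ?_
  refine Eq.symm ?_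
  rw [← (Equiv.prodCongr (flipBy σ u) (Equiv.refl Y)).sum_comp]
  refine Finset.sum_congr rfl fun q _ => ?_
  simp only [Equiv.prodCongr_apply, Prod.map, Equiv.refl_apply, Equiv.symm_apply_apply]
  ring

variable {π} {f : X × Y → Z}

theorem Performs.output_denoise (h : π.Performs f (noisyInput σ hε μ) 0)
    {ω : (π.noisy σ hε).Sample} (h0 : (π.noisy σ hε).law μ ω ≠ 0) :
    π.output (π.denoise σ hε ω) = f (flipBy σ ω.2.2.1.2 ω.1.1, ω.1.2) := by
  classical
  by_contra hne
  unfold Performs at h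
  rw [prob_eq_sum_ite, ← π.sum_denoise σ hε μ] at h
  have h1 := prob_pos (E := fun ω => π.output (π.denoise σ hε ω) ≠
    f (flipBy σ ω.2.2.1.2 ω.1.1, ω.1.2)) ((π.noisy σ hε).law_nonneg μ) h0 hne
  rw [prob_eq_sum_ite] at h1
  exact absurd h (not_le.2 h1)

/-- An error requires that the coin shows `true`, since otherwise the correct protocol runs on the
true input. -/
theorem Performs.noisy (h : π.Performs f (noisyInput σ hε μ) 0) :
    (π.noisy σ hε).Performs f μ ε := by
  classical
  refine (prob_mono (F := fun ω => ω.2.2.1.2 = true) ((π.noisy σ hε).law_nonneg μ)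
    fun ω h0 hne => ?_).trans (le_of_eq ?_)
  · by_contra hu
    have hu' : ω.2.2.1.2 = false := by simpa using hu
    exact hne ((π.output_noisy σ hε ω).trans ((h.output_denoise σ hε μ h0).trans
      (congrArg (fun u => f (flipBy σ u ω.1.1, ω.1.2)) hu')))
  · rw [prob_eq_sum_ite]
    refine Eq.trans ?_ ((π.sum_noisy σ hε μ fun x _ => if x.2 = true then 1 else 0).trans ?_)
    · exact Finset.sum_congr rfl fun ω _ => congrArg _ (by congr)
    have h1 : ∑ q, μ q = 1 := μ.2.2
    have h2 : ∑ q, π.publicLaw q = 1 := π.publicLaw.2.2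
    have h3 : ∑ q, π.aliceLaw q = 1 := π.aliceLaw.2.2
    have h4 : ∑ q, π.bobLaw q = 1 := π.bobLaw.2.2
    simp only [← Finset.sum_mul, h2, h3, h4, one_mul]
    simp [coin, ← Finset.sum_mul, h1]

/-- Noise on Alice's input lowers the information cost by `Ω(h(ε))`. -/
theorem infoCost_noisy_add_le [DecidableEq X] {x₀ x₁ : X} {y₀ : Y} (hf : f (x₁, y₀) ≠ f (x₀, y₀))
    (h : π.Performs f (noisyInput (Equiv.swap x₀ x₁) hε μ) 0) :
    (π.noisy (Equiv.swap x₀ x₁) hε).infoCost μ + μ (x₀, y₀) * binEnt ε ≤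
      π.infoCost (noisyInput (Equiv.swap x₀ x₁) hε μ) := by
  set σ := Equiv.swap x₀ x₁
  set π' := π.noisy σ hε
  set p := π'.law μ
  set T := fun ω => π.transcript (π.denoise σ hε ω)
  set X' : π'.Sample → X := fun ω => flipBy σ ω.2.2.1.2 ω.1.1
  -- `W` is what a zero-error transcript reveals about the coin.
  set W : π'.Sample → Prop := fun ω => X' ω = x₀ ∧ π'.inputY ω = y₀
  have hp : ∀ ω, 0 ≤ p ω := π'.law_nonneg μ
  have hT' : π'.transcript = T := funext (π.transcript_noisy σ hε)
  have h1 := condMutualInfo_comp (π.sum_denoise σ hε μ) π.transcript π.inputX π.inputY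
  have h2 := condMutualInfo_comp (π.sum_denoise σ hε μ) π.transcript π.inputY π.inputX
  rw [infoCost, infoCost, ← h1, ← h2]
  have hcoin := coin_nonneg hε
  have hk : ∀ φ : (X × Y) × Bool → ℝ, ∑ ω, p ω * φ (ω.1, ω.2.2.1.2) =
      ∑ x, μ x.1 * coin ε x.2 * φ x := by
    intro φ
    rw [π.sum_noisy σ hε μ fun x _ => φ x, Fintype.sum_prod_type (α₁ := X × Y)]
    have h2 : ∑ q, π.publicLaw q = 1 := π.publicLaw.2.2
    have h3 : ∑ q, π.aliceLaw q = 1 := π.aliceLaw.2.2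
    have h4 : ∑ q, π.bobLaw q = 1 := π.bobLaw.2.2
    simp only [← Finset.sum_mul, h2, h3, h4, one_mul, Finset.mul_sum, mul_assoc]
  have hk' : ∀ φ : ((X × Y) × Bool) × (π.PublicString × π.AliceString × π.BobString) → ℝ,
      ∑ ω, p ω * φ ((ω.1, ω.2.2.1.2), (ω.2.1, ω.2.2.1.1, ω.2.2.2)) =
      ∑ x, (μ x.1.1 * coin ε x.1.2) *
        (π.publicLaw x.2.1 * (π.aliceLaw x.2.2.1 * π.bobLaw x.2.2.2)) * φ x := by
    intro φ
    rw [π.sum_noisy σ hε μ fun x z => φ (x, z)]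
    simp only [Fintype.sum_prod_type (α₁ := (X × Y) × Bool), Fintype.sum_prod_type (α₁ := X × Y),
      Fintype.sum_prod_type (α₁ := π.PublicString), Fintype.sum_prod_type (α₁ := π.AliceString),
      Finset.mul_sum, mul_assoc]
  have hp₁ : ∀ x : (X × Y) × Bool, 0 ≤ μ x.1 * coin ε x.2 := fun x =>
    mul_nonneg (μ.2.1 _) (hcoin _)
  have hp₂ : ∀ x : π.PublicString × π.AliceString × π.BobString,
      0 ≤ π.publicLaw x.1 * (π.aliceLaw x.2.1 * π.bobLaw x.2.2) := fun x =>
    mul_nonneg (π.publicLaw.2.1 _) (mul_nonneg (π.aliceLaw.2.1 _) (π.bobLaw.2.1 _))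
  have hp₂' : ∑ x : π.PublicString × π.AliceString × π.BobString,
      π.publicLaw x.1 * (π.aliceLaw x.2.1 * π.bobLaw x.2.2) = 1 := by
    have h2 : ∑ q, π.publicLaw q = 1 := π.publicLaw.2.2
    have h3 : ∑ q, π.aliceLaw q = 1 := π.aliceLaw.2.2
    have h4 : ∑ q, π.bobLaw q = 1 := π.bobLaw.2.2
    simp [Fintype.sum_prod_type, ← Finset.mul_sum, h2, h3, h4]
  set F : X × Y → π.PublicString × π.AliceString × π.BobString → π.PublicString × List Bool :=
    fun q z => π.transcript (q, z)
  have hW : condEntropy p W (fun ω => (π'.inputX ω, π'.inputY ω)) =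
      ∑ q, μ q * entropy (coin ε) (fun u => flipBy σ u q.1 = x₀ ∧ q.2 = y₀) :=
    condEntropy_of_indep (α := X × Y) (k₁ := fun ω : π'.Sample => ω.1)
      (k₂ := fun ω : π'.Sample => ω.2.2.1.2) μ.2.1 hcoin (sum_coin ε) hk id
      (fun q u => flipBy σ u q.1 = x₀ ∧ q.2 = y₀)
  -- Only the input `(x₀, y₀)` is kept in the average; there `W` says precisely that the coin shows
  -- `false`.
  have hgain : μ (x₀, y₀) * binEnt ε ≤ condEntropy p W (fun ω => (π'.inputX ω, π'.inputY ω)) := by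
    rw [hW]
    have hent : entropy (coin ε) (fun u => flipBy σ u x₀ = x₀ ∧ y₀ = y₀) = binEnt ε := by
      have hne : x₁ ≠ x₀ := fun h => hf (by rw [h])
      rw [← entropy_coin]
      refine entropy_congr hcoin fun u u' _ _ => ?_
      cases u <;> cases u' <;> simp [flipBy, σ, hne]
    rw [← hent]
    exact Finset.single_le_sum (f := fun q : X × Y => μ q * entropy (coin ε)
      (fun u => flipBy σ u q.1 = x₀ ∧ q.2 = y₀)) (fun q _ => mul_nonneg (μ.2.1 q)
        (entropy_nonneg hcoin (sum_coin ε) _)) (Finset.mem_univ (x₀, y₀))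
  -- If `W` holds in `ω`, the common input of Alice is `x₀` or `x₁`, so `X' ω'` is one of these as
  -- well. The common transcript fixes the value of `f`, which separates them at `y₀`.
  have hWT : ∀ ω ω', p ω ≠ 0 → p ω' ≠ 0 → T ω = T ω' → π'.inputX ω = π'.inputX ω' →
      π'.inputY ω = π'.inputY ω' → W ω → W ω' := by
    rintro ω ω' h0 h0' hTT hX hY ⟨hx, hy⟩
    refine ⟨?_, hY ▸ hy⟩
    have ho : π.output (π.denoise σ hε ω) = π.output (π.denoise σ hε ω') := by
      have e1 := (Prod.ext_iff.1 hTT).1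
      have e2 := (Prod.ext_iff.1 hTT).2
      have e3 : ∀ ω : π.Sample, π.output ω = (π.tree (π.transcript ω).1).label (π.transcript ω).2 :=
        fun ω => (ProtocolTree.label_bits _ _ _).symm
      rw [e3, e3, e1, e2]
    rw [h.output_denoise σ hε μ h0, h.output_denoise σ hε μ h0'] at ho
    have ho' : f (X' ω, π'.inputY ω) = f (X' ω', π'.inputY ω') := ho
    rw [hx, ← hY, hy] at ho'
    have hmem : ∀ ω : π'.Sample, X' ω = π'.inputX ω ∨ X' ω = σ (π'.inputX ω) := by
      intro ω
      change flipBy σ ω.2.2.1.2 ω.1.1 = ω.1.1 ∨ flipBy σ ω.2.2.1.2 ω.1.1 = σ ω.1.1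
      cases ω.2.2.1.2 <;> simp [flipBy]
    have hσ : ∀ x, σ x = x₀ → x = x₁ := fun x hx => by
      simpa [σ] using congrArg σ hx
    have hX'' : X' ω' = x₀ ∨ X' ω' = x₁ := by
      have hin : π'.inputX ω' = x₀ ∨ π'.inputX ω' = x₁ := by
        rw [← hX]
        exact (hmem ω).imp (fun e => e.symm.trans hx) fun e => hσ _ (e.symm.trans hx)
      rcases hmem ω' with e | e <;> rcases hin with e' | e' <;> simp [e, e', σ]
    rcases hX'' with h' | h'
    · exact h'
    · rw [h'] at ho'
      exact absurd ho'.symm hf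
  -- Given `(X', Y)`, the transcript depends only on the randomness of `π`; given `X`, the noisy
  -- `X'` depends only on the coin.
  have key := condMutualInfo_add_le_of_noise hp T π'.inputX X' π'.inputY W
    ((condEntropy_of_indep (k₁ := fun ω : π'.Sample => (ω.1, ω.2.2.1.2))
        (k₂ := fun ω : π'.Sample => (ω.2.1, ω.2.2.1.1, ω.2.2.2)) hp₁ hp₂ hp₂' hk'
        (fun x => (x.1.1, flipBy σ x.2 x.1.1, x.1.2)) (fun v => F v.2)).trans
      (condEntropy_of_indep (k₁ := fun ω : π'.Sample => (ω.1, ω.2.2.1.2))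
        (k₂ := fun ω : π'.Sample => (ω.2.1, ω.2.2.1.1, ω.2.2.2)) hp₁ hp₂ hp₂' hk'
        (fun x => (flipBy σ x.2 x.1.1, x.1.2)) F).symm)
    ((condEntropy_of_indep (k₁ := fun ω : π'.Sample => ω.1)
        (k₂ := fun ω : π'.Sample => ω.2.2.1.2) μ.2.1 hcoin (sum_coin ε) hk id
        (fun q u => flipBy σ u q.1)).trans
      (condEntropy_of_indep (k₁ := fun ω : π'.Sample => ω.1)
        (k₂ := fun ω : π'.Sample => ω.2.2.1.2) μ.2.1 hcoin (sum_coin ε) hk Prod.fst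
        (fun x u => flipBy σ u x)).symm)
    (fun ω ω' e1 _ e2 => by simp only [W, e1, e2])
    (fun ω ω' h0 h0' e1 e2 e3 => propext ⟨hWT ω ω' h0 h0' e1 e2 e3,
      hWT ω' ω h0' h0 e1.symm e2.symm e3.symm⟩)
  rw [hT']
  exact (add_le_add le_rfl hgain).trans key

end Protocol

end Noise

/-! ### The gain from allowing errors -/

section UpperBound

variable {X Y Z : Type*} {f : X × Y → Z}

/-- A single player can change the value of `f` at `q`. -/
def Sensitive (f : X × Y → Z) (q : X × Y) : Prop :=
  (∃ x, f (x, q.2) ≠ f q) ∨ ∃ y, f (q.1, y) ≠ f q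

/-- Changing one coordinate at a time, the value must change at one of the two moves. -/
theorem exists_sensitive (hf : ∃ p q : X × Y, f p ≠ f q) : ∃ q, Sensitive f q := by
  obtain ⟨⟨x, y⟩, ⟨x', y'⟩, h⟩ := hf
  by_cases h1 : f (x', y) = f (x, y)
  · exact ⟨(x', y), Or.inr ⟨y', fun h2 => h (h1.symm.trans h2.symm)⟩⟩
  · exact ⟨(x, y), Or.inl ⟨x', h1⟩⟩

variable [Fintype X] [Fintype Y]

/-- Every zero-error protocol for the noisy input law yields, by adding noise, a cheaper protocol
for `μ` with error `ε`. -/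
theorem infoComplexity_add_le_of_alice {x₀ x₁ : X} {y₀ : Y} (hf : f (x₁, y₀) ≠ f (x₀, y₀))
    (μ : stdSimplex ℝ (X × Y)) {ε : ℝ} (hε : ε ∈ Set.Icc (0 : ℝ) 1) :
    infoComplexity μ f μ ε + μ (x₀, y₀) * binEnt ε ≤ maxDistInfoComplexity f 0 := by
  classical
  refine le_trans ?_ (infoComplexity_le_maxDistInfoComplexity f
    (noisyInput (Equiv.swap x₀ x₁) hε μ) le_rfl)
  refine le_infoComplexity le_rfl fun π hπ => ?_
  exact (add_le_add (infoComplexity_le (hπ.noisy _ hε μ)) le_rfl).trans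
    (Protocol.infoCost_noisy_add_le hε μ hf hπ)

theorem infoComplexity_add_le {q : X × Y} (hq : Sensitive f q)
    (μ : stdSimplex ℝ (X × Y)) {ε : ℝ} (hε : ε ∈ Set.Icc (0 : ℝ) 1) :
    infoComplexity μ f μ ε + μ q * binEnt ε ≤ maxDistInfoComplexity f 0 := by
  rcases hq with ⟨x, hx⟩ | ⟨y, hy⟩
  · exact infoComplexity_add_le_of_alice hx μ hε
  · have : Nonempty (X × Y) := ⟨q⟩
    have h := infoComplexity_add_le_of_alice (f := fun q : Y × X => f q.swap) (x₀ := q.2) (x₁ := y)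
      (y₀ := q.1) hy (swapInput μ) hε
    rw [infoComplexity_swap f μ hε.1] at h
    exact h.trans (maxDistInfoComplexity_swap_le f le_rfl)

theorem one_le_maxDistInfoComplexity (hf : ∃ p q : X × Y, f p ≠ f q) :
    1 ≤ maxDistInfoComplexity f 0 := by
  classical
  obtain ⟨q, hq⟩ := exists_sensitive hf
  -- For the point mass at a sensitive input and a fair coin, the gain is `h(1/2) = 1`.
  have h := infoComplexity_add_le hq ⟨Pi.single q 1, single_mem_stdSimplex ℝ q⟩
    (ε := 1 / 2) ⟨by norm_num, by norm_num⟩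
  have h1 : (⟨Pi.single q 1, single_mem_stdSimplex ℝ q⟩ : stdSimplex ℝ (X × Y)) q = 1 :=
    Pi.single_eq_same (M := fun _ => ℝ) q 1
  rw [h1, one_mul, binEnt_half] at h
  have := infoComplexity_nonneg f ⟨Pi.single q 1, single_mem_stdSimplex ℝ q⟩ (ε := 1 / 2)
    (by norm_num)
  linarith

/-- Zero-error information complexity is small if most of the mass is on insensitive inputs. -/
theorem infoComplexity_le_of_sensitive (μ : stdSimplex ℝ (X × Y)) {d : ℝ} (hd1 : d < 1)
    (hd : prob (fun q => μ q) (Sensitive f) ≤ d) :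
    infoComplexity μ f μ 0 ≤ 2 * (Fintype.card (X × Y) * binEntMono d) := by
  classical
  have hμ : ∑ q, μ q = 1 := μ.2.2
  obtain ⟨⟨x₀, y₀⟩, hq⟩ : ∃ q, ¬ Sensitive f q := by
    by_contra! hall
    have : prob (fun q => μ q) (Sensitive f) = 1 := by
      rw [← hμ]
      exact Finset.sum_congr (by simp [hall]) fun _ _ => rfl
    linarith
  have : Nonempty X := ⟨x₀⟩
  have : Nonempty Y := ⟨y₀⟩
  obtain ⟨D, hD⟩ := ProtocolTree.exists_forall_output_eq f
  -- Outside `S`, Alice knows that the value is `f (x₀, y₀)`, so Bob need not check anything. Since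
  -- `(x₀, y₀)` is insensitive, all pairs with `x ∈ S` are sensitive and thus rare.
  set S : Set X := {x | ∃ y, f (x, y) ≠ f (x₀, y₀)}
  have hSs : ∀ q : X × Y, q.1 ∈ S → Sensitive f q := by
    rintro ⟨x, y⟩ ⟨y', hy'⟩
    by_contra hn
    simp only [Sensitive, not_or, not_exists, not_not] at hq hn
    exact hy' ((hn.2 y').trans ((hn.1 x₀).symm.trans (hq.2 y)))
  set t := ProtocolTree.check S ∅ (f (x₀, y₀)) D
  set π := Protocol.ofTree t
  have hπ : π.Performs f μ 0 := by
    refine Protocol.performs_of_forall le_rfl fun ω _ => ?_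
    rw [Protocol.output_ofTree]
    by_cases h : π.inputX ω ∈ S
    · rw [ProtocolTree.output_check_of_mem _ _ (Or.inl h), hD]
    · rw [ProtocolTree.output_check_of_notMem _ _ (by simpa using h)]
      by_contra hne
      exact h ⟨_, fun e => hne e.symm⟩
  refine (infoComplexity_le hπ).trans ?_
  refine (π.infoCost_le_entropy μ (E := fun ω => if ω.1.1 ∈ S then some ω.1 else none)
    fun ω ω' h => ?_).trans (mul_le_mul_of_nonneg_left ?_ zero_le_two)
  · rw [Protocol.transcript_ofTree, Protocol.transcript_ofTree]
    split_ifs at h with h1 h2 h2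
    · rw [Option.some.inj h]
    · rw [ProtocolTree.bits_check_of_notMem _ _ (by simpa using h1),
        ProtocolTree.bits_check_of_notMem _ _ (by simpa using h2)]
  · refine entropy_option_le_binEntMono (π.law_nonneg μ) (π.sum_law μ) _ (le_trans ?_ hd)
    rw [← Protocol.prob_ofTree t μ]
    refine prob_mono (π.law_nonneg μ) fun ω _ h => hSs _ ?_
    by_contra h'
    exact h (if_neg h')

theorem exists_binEntMono_le {c : ℝ} (hc : 0 < c) : ∃ d : ℝ, 0 < d ∧ d < 1 ∧ binEntMono d ≤ c := by
  have h : Filter.Tendsto binEnt (nhds 0) (nhds 0) := by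
    have := (Real.binEntropy_continuous.div_const (Real.log 2)).tendsto 0
    rwa [Real.binEntropy_zero, zero_div] at this
  obtain ⟨δ, hδ, hball⟩ := Metric.eventually_nhds_iff.1 (h.eventually_le_const hc)
  refine ⟨min (δ / 2) (1 / 2), by positivity, (min_le_right _ _).trans_lt (by norm_num), ?_⟩
  rw [binEntMono, min_eq_left (min_le_right _ _)]
  refine hball ?_
  rw [Real.dist_eq, sub_zero, abs_of_nonneg (by positivity)]
  exact (min_le_left _ _).trans_lt (by linarith)

/-- The threshold `d` for the sensitive mass depends only on `|X × Y|`. Below it the zero-error cost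
is at most `1/2`, leaving a gap of `1/2`; above it some sensitive input has mass at least `d / N`,
and noise gives the gain. -/
theorem exists_maxDistInfoComplexity_le (hf : ∃ p q : X × Y, f p ≠ f q) :
    ∃ c : ℝ, 0 < c ∧ ∀ ε ∈ Set.Icc (0 : ℝ) 1,
      maxDistInfoComplexity f ε ≤ maxDistInfoComplexity f 0 - c * binEnt ε := by
  classical
  obtain ⟨q₀, -⟩ := exists_sensitive hf
  have : Nonempty (X × Y) := ⟨q₀⟩
  set N : ℝ := (Fintype.card (X × Y) : ℝ)
  have hN : 0 < N := Nat.cast_pos.2 Fintype.card_pos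
  -- The value `1 / (4 * N)` makes the bound `2 * (N * binEntMono d)` at most `1/2`.
  obtain ⟨d, hd0, hd1, hd⟩ := exists_binEntMono_le (show 0 < 1 / (4 * N) by positivity)
  refine ⟨min (1 / 2) (d / N), by positivity, ?_⟩
  suffices h : ∀ ε ∈ Set.Icc (0 : ℝ) 1, ∀ μ : stdSimplex ℝ (X × Y), infoComplexity μ f μ ε ≤
      maxDistInfoComplexity f 0 - min (1 / 2) (d / N) * binEnt ε by
    exact fun ε hε => ciSup_le (h ε hε)
  intro ε hε μ
  have hent0 := binEnt_nonneg hε.1 hε.2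
  by_cases hs : prob (fun q => μ q) (Sensitive f) ≤ d
  · have h1 := infoComplexity_le_of_sensitive μ hd1 hs
    have h2 := infoComplexity_anti f μ le_rfl hε.1
    have h3 := one_le_maxDistInfoComplexity hf
    have h4 : 2 * (N * binEntMono d) ≤ 1 / 2 := by
      have := mul_le_mul_of_nonneg_left hd hN.le
      have e : N * (1 / (4 * N)) = 1 / 4 := by field_simp
      linarith
    have h5 := mul_le_mul (min_le_left (1 / 2) (d / N)) (binEnt_le_one ε) hent0 (by norm_num)
    linarith
  · obtain ⟨q, hq, hle⟩ : ∃ q, Sensitive f q ∧ d / N ≤ μ q := by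
      by_contra! hall
      refine hs ?_
      rw [prob_eq_sum_ite]
      have : ∀ q ∈ Finset.univ, μ q * (if Sensitive f q then 1 else 0) ≤ d / N := by
        intro q _
        by_cases hq : Sensitive f q
        · simpa [hq] using (hall q hq).le
        · simp only [hq, if_false, mul_zero]
          positivity
      refine (Finset.sum_le_card_nsmul _ _ _ this).trans (le_of_eq ?_)
      rw [nsmul_eq_mul, Finset.card_univ]
      exact mul_div_cancel₀ d hN.ne'
    have h1 := infoComplexity_add_le hq μ hε
    have h2 := mul_le_mul_of_nonneg_right ((min_le_right (1 / 2) (d / N)).trans hle) hent0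
    linarith

end UpperBound

theorem mainTheorem10 {X Y Z : Type*} [Fintype X] [Fintype Y] (f : X × Y → Z)
    (hf : ∃ p q : X × Y, f p ≠ f q) :
    ((∃ μ : stdSimplex ℝ (X × Y), infoComplexity μ f μ 0 = maxDistInfoComplexity f 0) →
      ∃ C : ℝ, 0 < C ∧ ∀ ε ∈ Set.Icc (0 : ℝ) 1,
        maxDistInfoComplexity f 0 - C * binEntMono (Real.sqrt ε) ≤ maxDistInfoComplexity f ε) ∧
    (∃ c : ℝ, 0 < c ∧ ∀ ε ∈ Set.Icc (0 : ℝ) 1,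
      maxDistInfoComplexity f ε ≤ maxDistInfoComplexity f 0 - c * binEnt ε) := by
  refine ⟨?_, exists_maxDistInfoComplexity_le hf⟩
  rintro ⟨μ, hμ⟩
  -- `C` depends on `μ`; a maximizer chosen once for `f` makes it independent of `ε`.
  obtain ⟨C, hC, h⟩ := infoComplexity_zero_le f μ
  refine ⟨C, hC, fun ε hε => ?_⟩
  rw [← hμ, sub_le_iff_le_add]
  exact (h ε hε.1).trans
    (add_le_add (infoComplexity_le_maxDistInfoComplexity f μ hε.1) le_rfl)
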